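/- **Notation.** For $p\in\mathbb N_0$, $k\in\mathbb Z$ let the logarithmic polynomials $R_p^k(x)$ be given by $R_0^0=1$, $R_0^k=0$ for $k\ne0$, and $$R_p^k(x)=\tfrac12R_{p-1}^{k-1}(x)+xR_{p-1}^k(x)+\tfrac12R_{p-1}^{k+1}(x)\qquad(p\ge1).$$ For $p\in\mathbb N_0$, $\mu\in\mathbb Z$, $z>1$ let $$P_p^\mu(z)=\Bigl(\frac{z+1}{z-1}\Bigr)^{\mu/2}\sum_{j=0}^{p}\frac{(-p)_j(p+1)_j}{j!\,\Gamma(1-\mu+j)}\Bigl(\frac{1-z}2\Bigr)^j$$ (with $1/\Gamma=0$ at the poles of $\Gamma$) be the associated Legendre function of the first kind, $P_p=P_p^0$; let $\psi=\Gamma'/\Gamma$ be the digamma function, and $\epsilon_0=1$, $\epsilon_n=2$ for $n\ge1$. For $n,p\in\mathbb N_0$ and $\eta>0$ put $$\Re_{n,p}(\cosh\eta)=2\sum_{k=-p}^{p}(-1)^{k+1}e^{k\eta}R_p^k(\cosh\eta)\prod_{\substack{-p\le j\le p\\ j\ne k}}(n-j).$$ **Theorem.** Let $\eta>0$. (a)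 For $n=0$ and $p\ge1$, $$\sum_{k=1}^{p}\frac{(-1)^{k+1}e^{-k\eta}R_p^k(\cosh\eta)}{k}=\sinh^p\eta\,[\psi(2p+1)-\psi(p+1)]P_p(\coth\eta)+(-1)^p\sinh^p\eta\sum_{k=0}^{p-1}\frac{(-1)^k(2k+1)}{(p-k)(p+k+1)}P_k(\coth\eta).$$ (b) For $p\ge2$ and $1\le n\le p-1$, $$\sum_{k=-p}^{n-1}\frac{(-1)^{k+1}e^{k\eta}R_p^k(\cosh\eta)}{n-k}+e^{2n\eta}\sum_{k=-p}^{-n-1}\frac{(-1)^{k}e^{k\eta}R_p^k(\cosh\eta)}{n+k}=p!\,e^{n\eta}\sinh^p\eta\;\Bigl\{\frac{(-1)^n}{(p+n)!}\bigl[2\psi(2p+1)-\psi(p+1+n)-\psi(p+1-n)\bigr]P_p^n(\coth\eta)$$ $$+\frac{(-1)^p}{(p+n)!}\sum_{k=0}^{p-n-1}\frac{(-1)^k(2n+2k+1)\bigl[1+\frac{k!(p+n)!}{(2n+k)!(p-n)!}\bigr]}{(p-n-k)(p+n+k+1)}P_{n+k}^n(\coth\eta)+\frac{(-1)^{p+n}}{(p-n)!}\sum_{k=0}^{n-1}\frac{(-1)^k(2k+1)}{(p-k)(p+k+1)}P_k^{-n}(\coth\eta)\Bigr\}.$$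 (c) For $n=p\ge1$, $$\sum_{k=-p}^{p-1}\frac{(-1)^{k+1}e^{k\eta}R_p^k(\cosh\eta)}{p-k}=p!\,e^{p\eta}\sinh^p\eta\Bigl\{\frac{(-1)^p}{(2p)!}[\psi(2p+1)-\psi(1)]P_p^p(\coth\eta)+\sum_{k=0}^{p-1}\frac{(-1)^k(2k+1)}{(p-k)(p+k+1)}P_k^{-p}(\coth\eta)\Bigr\}.$$ (d) For $p\ge0$ and $n\ge p+1$, $$\sum_{k=-p}^{p}\frac{(-1)^{k+1}e^{k\eta}R_p^k(\cosh\eta)}{n-k}=(-1)^{p+1}p!\,(n-p-1)!\,e^{n\eta}\sinh^p\eta\,P_p^{-n}(\coth\eta).$$ (e) For $p\ge0$ and $n\ge p+1$, $$\Re_{n,p}(\cosh\eta)=\frac{(n+p)!}{(n-p-1)!}\cdot2\sum_{k=-p}^{p}\frac{(-1)^{k+1}e^{k\eta}R_p^k(\cosh\eta)}{n-k},$$ and for all $n,p\ge0$, $$\Re_{n,p}(\cosh\eta)=2(-1)^{p+1}p!\,(p+n)!\,e^{n\eta}\sinh^p\eta\,P_p^{-n}(\coth\eta).$$ (f) For every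 integer $q\ge1$ and every real $\psi$, with an absolutely convergent series, $$\frac1{(\cosh\eta-\cos\psi)^q}=\frac{(-1)^q}{2[(q-1)!]^2\sinh^{2q-1}\eta}\sum_{n=0}^\infty\epsilon_n\cos(n\psi)\,e^{-n\eta}\,\Re_{n,q-1}(\cosh\eta).$$ -/

import Mathlib

/-- The logarithmic polynomials `R_p^k`, `p ∈ ℕ₀`, `k ∈ ℤ`: `R_0^k = δ_{k,0}` and
`R_{p+1}^k = R_p^{k-1} / 2 + x R_p^k + R_p^{k+1} / 2`. -/
noncomputable def logPoly : ℕ → ℤ → Polynomial ℝ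
  | 0, k => if k = 0 then 1 else 0
  | p + 1, k =>
      Polynomial.C (1 / 2) * logPoly p (k - 1) + Polynomial.X * logPoly p k
        + Polynomial.C (1 / 2) * logPoly p (k + 1)

/-- The associated Legendre function of the first kind `P_p^μ : (1, ∞) → ℝ` of degree `p ∈ ℕ₀` and
order `μ ∈ ℤ`,
`P_p^μ(z) = ((z+1)/(z-1))^{μ/2} · (1/Γ(1-μ)) ₂F₁(-p, p+1; 1-μ; (1-z)/2)`.
The quotient `₂F₁(a, b; c; ·)/Γ(c)` is the regularized Gauss function, which is also defined at
`c = 0, -1, -2, …` (here: `μ ≥ 1`). As the degree is a natural number the series terminates, so it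
converges for every `z`, and its value is real (`legendreP_eq_sum`). -/
noncomputable def legendreP (p : ℕ) (μ : ℤ) (z : ℝ) : ℝ :=
  ((z + 1) / (z - 1)) ^ ((μ : ℝ) / 2) *
    (Complex.regularizedGaussHGFun (-(p : ℂ)) ((p : ℂ) + 1) (1 - (μ : ℂ))
      (((1 - z) / 2 : ℝ) : ℂ)).re

/-- The digamma function on the real line (it is real there). -/
noncomputable def realDigamma (x : ℝ) : ℝ := (Complex.digamma (x : ℂ)).re

/-- The Neumann factor `ε_n = 2 - δ_{n,0}`. -/
def neumannFactor (n : ℕ) : ℝ := if n = 0 then 1 else 2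

/-- `e^η` as a function of `x = cosh η`, `η > 0`. -/
noncomputable def expArcosh (x : ℝ) : ℝ := x + √(x ^ 2 - 1)

/-- `𝔯_{n,p}^{k₁,k₂}(x) = 2 ∑_{k=k₁}^{k₂} (-1)^{k+1} e^{kη} R_p^k(x) / (n - k)`, `x = cosh η`. It is
meaningful when `n` is not one of the summation indices. -/
noncomputable def logSum (n : ℤ) (p : ℕ) (k₁ k₂ : ℤ) (x : ℝ) : ℝ :=
  2 * ∑ k ∈ Finset.Icc k₁ k₂,
    (-1 : ℝ) ^ (k + 1) * expArcosh x ^ k * (logPoly p k).eval x / ((n : ℝ) - (k : ℝ))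

/-- The ending function `ℜ_{n,p}(x)`. For `n ≥ p + 1` it is `(n+p)!/(n-p-1)! · 𝔯_{n,p}^{-p,p}(x)`.
Since `(n+p)!/(n-p-1)! = ∏_{j=-p}^{p} (n - j)`, the factor `n - k` cancels in each summand; after
this cancellation the expression is a polynomial in `n`, which makes sense for all `n ≥ 0`. -/
noncomputable def endingFun (n p : ℕ) (x : ℝ) : ℝ :=
  2 * ∑ k ∈ Finset.Icc (-(p : ℤ)) (p : ℤ),
    (-1 : ℝ) ^ (k + 1) * expArcosh x ^ k * (logPoly p k).eval x *
      ∏ j ∈ (Finset.Icc (-(p : ℤ)) (p : ℤ)).erase k, ((n : ℝ) - (j : ℝ))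

theorem legendreP_eq_sum (p : ℕ) (μ : ℤ) (z : ℝ) :
    legendreP p μ z = ((z + 1) / (z - 1)) ^ ((μ : ℝ) / 2) *
      ∑ j ∈ Finset.range (p + 1),
        (ascPochhammer ℝ j).eval (-(p : ℝ)) * (ascPochhammer ℝ j).eval ((p : ℝ) + 1)
          / (j.factorial * Real.Gamma (1 - μ + j)) * ((1 - z) / 2) ^ j := by
  have key : Complex.regularizedGaussHGFun (-(p : ℂ)) ((p : ℂ) + 1) (1 - (μ : ℂ))
      (((1 - z) / 2 : ℝ) : ℂ) = ((∑ j ∈ Finset.range (p + 1),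
        (ascPochhammer ℝ j).eval (-(p : ℝ)) * (ascPochhammer ℝ j).eval ((p : ℝ) + 1)
          / (j.factorial * Real.Gamma (1 - μ + j)) * ((1 - z) / 2) ^ j : ℝ) : ℂ) := by
    have hpoch : ∀ (j : ℕ) (x : ℝ),
        (((ascPochhammer ℝ j).eval x : ℝ) : ℂ) = (ascPochhammer ℂ j).eval (x : ℂ) := by
      intro j x
      rw [← ascPochhammer_map Complex.ofRealHom, Polynomial.eval_map]
      exact (Polynomial.eval₂_at_apply Complex.ofRealHom x).symm
    unfold Complex.regularizedGaussHGFun FormalMultilinearSeries.sum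
    rw [tsum_eq_sum (s := Finset.range (p + 1))]
    · push_cast
      refine Finset.sum_congr rfl fun j _ => ?_
      rw [FormalMultilinearSeries.apply_eq_pow_smul_coeff,
        Complex.coeff_regularizedGaussHGFunSeries, ← Complex.Gamma_ofReal, hpoch, hpoch]
      push_cast
      rw [smul_eq_mul, mul_comm]
    · intro j hj
      have hj' : p < j := by
        rw [Finset.mem_range] at hj
        omega
      rw [FormalMultilinearSeries.apply_eq_pow_smul_coeff,
        Complex.coeff_regularizedGaussHGFunSeries]
      have h0 : (ascPochhammer ℂ j).eval (-(p : ℂ)) = 0 := by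
        refine (ascPochhammer_eval_eq_zero_iff j _).2 ?_
        exact ⟨p, hj', by simp⟩
      simp [h0]
  rw [legendreP, key, Complex.ofReal_re]

/-!
Throughout `y = (1 - coth η) / 2` (`legendreArg η`), the argument of the Gauss function in
`P_p^μ(coth η)`. In this variable everything in sight is a polynomial with binomial coefficients.

The generating function `∑ R_p^k(x) t^k = (x + (t + t⁻¹) / 2) ^ p` becomes, after the substitution
`v = e^{-η} / t`, a power of `(1 + v) (1 - y (1 + v))`, whence (`exp_mul_logPoly_eq_sum`)
`e^{(p-r)η} R_p^{p-r}(cosh η) = sinh^p η ∑_j (-1)^j C(p, j) C(p + j, r) y^j`, and up to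
factorials the sum on the right is `P_p^{r-p}(coth η)`. This makes each assertion an identity between
polynomials in `y`.

*Singular index.* For an index `p - D ∈ [-p, p]` the logarithmic sum over `k < p - D` has a closed
form of its own (`sum_logPoly_div`), of which the cases `n = 0` and `n = p` are instances, while for
`1 ≤ n ≤ p - 1` the two sums are the instances of index `n` and `-n`. On the left the coefficient of
`y^j` is an alternating sum of binomial coefficients over `l`, equal to
`C(p + j, D) (H_{p+j} - H_D)` (`sum_alternating_choose_add_div`). On the right the digamma values
give `H_{2p} - H_D`, and the combination of Legendre functions of lower degree supplies the missing
`H_{p+j} - H_{2p}` (`sum_factorialRatio_div`): its denominators `(p - k) (p + k + 1)` are differences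
of eigenvalues of the Legendre operator, so that stepping from `j` to `j + 1` cancels them and leaves
a telescoping sum. The Legendre functions of order `n` and `-n` are proportional because
`R_p^{-k} = R_p^k`.

*Ending function.* Coefficientwise in `y` the closed form is the partial fraction decomposition of
`N! / (u (u + 1) ⋯ (u + N))` at `u = n - p`, cleared of denominators, so it holds for every `n`
(`sum_choose_mul_prod_erase`). For `n ≥ p + 1` one may divide by `∏ (n - j)`, which gives the
logarithmic sum.

*Fourier series.* Multiplying a cosine series by `cosh η - cos ψ` applies a three-term difference
operator to the coefficients. By Pascal's rule it carries the coefficients belonging to the exponent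
`p + 2` to those belonging to `p + 1` (`fourierInversePower_recurrence`), and the coefficients of
exponent `1` to a single nonzero one. Induction on the exponent gives the expansion.
-/

/-! ### Binomial and harmonic sums -/

theorem sum_alternating_choose_div (N L : ℕ) (h : N < L) :
    ∑ l ∈ Finset.range L, (-1 : ℝ) ^ l * (N.choose l : ℝ) / (l + 1) = 1 / (N + 1) := by
  have h1 : ∀ l ∈ Finset.range L, (-1 : ℝ) ^ l * (N.choose l : ℝ) / (l + 1)
      = -(1 / (N + 1)) * ((-1 : ℝ) ^ (l + 1) * ((N + 1).choose (l + 1) : ℝ)) := by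
    intro l _
    have := Nat.add_one_mul_choose_eq N l
    have h2 : ((N : ℝ) + 1) * N.choose l = (N + 1).choose (l + 1) * ((l : ℝ) + 1) := by
      exact_mod_cast this
    have : (l : ℝ) + 1 ≠ 0 := by positivity
    have : (N : ℝ) + 1 ≠ 0 := by positivity
    field_simp
    rw [pow_succ]
    linear_combination (-1 : ℝ) ^ l * h2
  rw [Finset.sum_congr rfl h1, ← Finset.mul_sum]
  have h3 : ∑ l ∈ Finset.range (L + 1), (-1 : ℝ) ^ l * ((N + 1).choose l : ℝ) = 0 := by
    rw [← Finset.sum_subset (s₁ := Finset.range (N + 1 + 1))]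
    · have := Int.alternating_sum_range_choose_of_ne (n := N + 1) (by omega)
      exact_mod_cast this
    · intro i hi
      simp only [Finset.mem_range] at hi ⊢
      omega
    · intro i _ hi
      simp only [Finset.mem_range, not_lt] at hi
      rw [Nat.choose_eq_zero_of_lt (by omega)]
      simp
  rw [Finset.sum_range_succ'] at h3
  have h4 : ∑ l ∈ Finset.range L, (-1 : ℝ) ^ (l + 1) * ((N + 1).choose (l + 1) : ℝ) = -1 := by
    simp only [pow_zero, Nat.choose_zero_right, Nat.cast_one, mul_one] at h3
    linarith
  rw [h4]
  ring

/-- The coefficient of `v ^ D` in `(1 + v) ^ N * log (1 + v⁻¹)`. -/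
theorem sum_alternating_choose_add_div (N : ℕ) : ∀ D L : ℕ, N ≤ D + L →
    ∑ l ∈ Finset.range L, (-1 : ℝ) ^ l * (N.choose (D + l + 1) : ℝ) / (l + 1)
      = N.choose D * ((harmonic N : ℝ) - harmonic D) := by
  induction N with
  | zero =>
    intro D L _
    rw [Finset.sum_eq_zero]
    · rcases D with _ | D <;> simp
    · intro l _
      simp [Nat.choose_eq_zero_of_lt]
  | succ N ih =>
    intro D L hL
    rcases D with _ | D
    · have e : ∀ l ∈ Finset.range L,
          (-1 : ℝ) ^ l * ((N + 1).choose (0 + l + 1) : ℝ) / (l + 1)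
            = (-1 : ℝ) ^ l * (N.choose l : ℝ) / (l + 1)
              + (-1 : ℝ) ^ l * (N.choose (0 + l + 1) : ℝ) / (l + 1) := by
        intro l _
        rw [Nat.zero_add, Nat.choose_succ_succ']
        push_cast
        ring
      rw [Finset.sum_congr rfl e, Finset.sum_add_distrib, ih 0 L (by omega),
        sum_alternating_choose_div N L (by omega), harmonic_succ]
      push_cast
      simp
      ring
    · have e : ∀ l ∈ Finset.range L,
          (-1 : ℝ) ^ l * ((N + 1).choose (D + 1 + l + 1) : ℝ) / (l + 1)
            = (-1 : ℝ) ^ l * (N.choose (D + l + 1) : ℝ) / (l + 1)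
              + (-1 : ℝ) ^ l * (N.choose (D + 1 + l + 1) : ℝ) / (l + 1) := by
        intro l _
        rw [Nat.choose_succ_succ', show D + 1 + l = D + l + 1 by ring]
        push_cast
        ring
      rw [Finset.sum_congr rfl e, Finset.sum_add_distrib, ih D L (by omega),
        ih (D + 1) L (by omega), harmonic_succ, harmonic_succ, Nat.choose_succ_succ' N D]
      have h2 : ((N : ℝ) + 1) * N.choose D
          = (N.choose D + N.choose (D + 1)) * ((D : ℝ) + 1) := by
        have := Nat.add_one_mul_choose_eq N D
        rw [Nat.choose_succ_succ'] at this
        exact_mod_cast this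
      have : (D : ℝ) + 1 ≠ 0 := by positivity
      have : (N : ℝ) + 1 ≠ 0 := by positivity
      push_cast
      field_simp
      linear_combination h2

/-- `(k + j)! / (k - j)!`, read as `0` for `j > k`. -/
noncomputable def factorialRatio (k j : ℕ) : ℝ := ((k + j).descFactorial (2 * j) : ℝ)

theorem factorialRatio_eq_zero {k j : ℕ} (h : k < j) : factorialRatio k j = 0 := by
  rw [factorialRatio, Nat.descFactorial_of_lt (by omega), Nat.cast_zero]

theorem factorialRatio_eq_div {k j : ℕ} (h : j ≤ k) :
    factorialRatio k j = ((k + j).factorial : ℝ) / (k - j).factorial := by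
  rw [factorialRatio, eq_div_iff (by positivity), mul_comm]
  have := Nat.factorial_mul_descFactorial (show 2 * j ≤ k + j by omega)
  rw [show k + j - 2 * j = k - j by omega] at this
  exact_mod_cast this

theorem factorialRatio_succ_right (k j : ℕ) :
    factorialRatio k (j + 1) = ((k : ℝ) - j) * (k + j + 1) * factorialRatio k j := by
  rcases lt_trichotomy k j with h | h | h
  · rw [factorialRatio_eq_zero h, factorialRatio_eq_zero (by omega), mul_zero]
  · rw [h, factorialRatio_eq_zero (Nat.lt_succ_self j)]
    simp
  · obtain ⟨d, rfl⟩ : ∃ d, k = j + 1 + d := ⟨k - (j + 1), by omega⟩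
    rw [factorialRatio_eq_div (by omega), factorialRatio_eq_div (by omega),
      show j + 1 + d - (j + 1) = d by omega, show j + 1 + d - j = d + 1 by omega,
      show j + 1 + d + (j + 1) = (j + 1 + d + j) + 1 by ring, Nat.factorial_succ,
      Nat.factorial_succ d]
    push_cast
    field_simp
    ring

theorem factorialRatio_succ_left (k j : ℕ) :
    ((k : ℝ) + 1 - j) * factorialRatio (k + 1) j = (k + j + 1) * factorialRatio k j := by
  rcases lt_trichotomy (k + 1) j with h | h | h
  · rw [factorialRatio_eq_zero h, factorialRatio_eq_zero (by omega), mul_zero, mul_zero]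
  · rw [factorialRatio_eq_zero (k := k) (by omega), ← h]
    simp
  · obtain ⟨d, rfl⟩ : ∃ d, k = j + d := ⟨k - j, by omega⟩
    rw [factorialRatio_eq_div (by omega), factorialRatio_eq_div (by omega),
      show j + d - j = d by omega, show j + d + 1 - j = d + 1 by omega,
      show j + d + 1 + j = (j + d + j) + 1 by ring, Nat.factorial_succ,
      Nat.factorial_succ d]
    push_cast
    field_simp
    ring

theorem sum_alternating_factorialRatio (p j : ℕ) :
    ∑ k ∈ Finset.range p, (-1 : ℝ) ^ k * (2 * k + 1) * factorialRatio k j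
      = -(-1 : ℝ) ^ p * (p - j) * factorialRatio p j := by
  induction p with
  | zero =>
    rcases j with _ | j
    · simp
    · rw [factorialRatio_eq_zero (Nat.succ_pos j)]
      simp
  | succ p ih =>
    rw [Finset.sum_range_succ, ih, pow_succ]
    push_cast
    linear_combination (-(-1 : ℝ) ^ p) * factorialRatio_succ_left p j

/-- The discrete analogue of resolving the inhomogeneous Legendre equation: the eigenvalue
differences `p (p + 1) - k (k + 1)` in the denominators turn the telescoping sum
`sum_alternating_factorialRatio` into a harmonic number. -/
theorem sum_factorialRatio_div (p j : ℕ) (hj : j ≤ p) :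
    (-1 : ℝ) ^ p * ∑ k ∈ Finset.range p,
        (-1 : ℝ) ^ k * (2 * (k : ℝ) + 1) / (((p : ℝ) - k) * ((p : ℝ) + k + 1))
          * factorialRatio k j
      = factorialRatio p j * ((harmonic (p + j) : ℝ) - harmonic (2 * p)) := by
  induction hj using Nat.decreasingInduction with
  | self =>
    rw [Finset.sum_eq_zero, ← two_mul]
    · simp
    · intro k hk
      rw [factorialRatio_eq_zero (Finset.mem_range.1 hk), mul_zero]
  | of_succ j hj ih =>
    set S := ∑ k ∈ Finset.range p,
        (-1 : ℝ) ^ k * (2 * (k : ℝ) + 1) / (((p : ℝ) - k) * ((p : ℝ) + k + 1))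
          * factorialRatio k j with hS
    -- `(k - j) (k + j + 1) = (p - j) (p + j + 1) - (p - k) (p + k + 1)`
    have e : ∑ k ∈ Finset.range p,
        (-1 : ℝ) ^ k * (2 * (k : ℝ) + 1) / (((p : ℝ) - k) * ((p : ℝ) + k + 1))
          * factorialRatio k (j + 1)
        = ((p : ℝ) - j) * (p + j + 1) * S
          - ∑ k ∈ Finset.range p, (-1 : ℝ) ^ k * (2 * k + 1) * factorialRatio k j := by
      rw [hS, Finset.mul_sum, ← Finset.sum_sub_distrib]
      refine Finset.sum_congr rfl fun k hk => ?_
      have hk' : (k : ℝ) < p := by exact_mod_cast Finset.mem_range.1 hk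
      have h1 : (p : ℝ) - k ≠ 0 := by linarith
      have h2 : (p : ℝ) + k + 1 ≠ 0 := by positivity
      rw [factorialRatio_succ_right]
      field_simp
      ring
    rw [e, sum_alternating_factorialRatio, factorialRatio_succ_right, ← add_assoc,
      harmonic_succ] at ih
    have h3 : (p : ℝ) - j ≠ 0 := by
      have : (j : ℝ) < p := by exact_mod_cast hj
      linarith
    have h4 : (p : ℝ) + j + 1 ≠ 0 := by positivity
    have h5 : (-1 : ℝ) ^ p * (-1 : ℝ) ^ p = 1 := by rw [← mul_pow]; simp
    push_cast at ih
    have h6 : ((p : ℝ) - j) * (p + j + 1) * ((-1 : ℝ) ^ p * S)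
        = ((p : ℝ) - j) * (p + j + 1)
          * (factorialRatio p j * ((harmonic (p + j) : ℝ) - harmonic (2 * p))) := by
      have h7 : ((p : ℝ) + j + 1) * ((p : ℝ) + j + 1)⁻¹ = 1 := mul_inv_cancel₀ h4
      linear_combination ih - (p - j) * factorialRatio p j * h5
        + (p - j) * factorialRatio p j * h7
    exact mul_left_cancel₀ (mul_ne_zero h3 h4) h6

/-! ### Closed forms in the variable `(1 - coth η) / 2` -/

/-- The argument `(1 - z) / 2` of the Gauss function in `P_p^μ(z)`, at `z = coth η`. -/
noncomputable def legendreArg (η : ℝ) : ℝ := (1 - Real.cosh η / Real.sinh η) / 2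

theorem sinh_mul_legendreArg {η : ℝ} (hη : 0 < η) :
    Real.sinh η * legendreArg η = -Real.exp (-η) / 2 := by
  have h : Real.sinh η ≠ 0 := (Real.sinh_pos_iff.2 hη).ne'
  rw [legendreArg, ← Real.cosh_sub_sinh]
  field_simp
  ring

theorem sinh_mul_one_sub_legendreArg {η : ℝ} (hη : 0 < η) :
    Real.sinh η * (1 - legendreArg η) = Real.exp η / 2 := by
  have h1 := sinh_mul_legendreArg hη
  have h2 := Real.cosh_sub_sinh η
  have h3 := Real.cosh_add_sinh η
  linarith

theorem logPoly_neg (p : ℕ) : ∀ k : ℤ, logPoly p (-k) = logPoly p k := by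
  induction p with
  | zero => intro k; simp [logPoly]
  | succ p ih =>
    intro k
    rw [logPoly, logPoly, show -k - 1 = -(k + 1) by ring, show -k + 1 = -(k - 1) by ring, ih, ih,
      ih]
    ring

theorem logPoly_eq_zero (p : ℕ) : ∀ k : ℤ, (p : ℤ) < k → logPoly p k = 0 := by
  induction p with
  | zero =>
    intro k hk
    have : k ≠ 0 := by
      rintro rfl
      simp at hk
    simp [logPoly, this]
  | succ p ih =>
    intro k hk
    push_cast at hk
    rw [logPoly, ih _ (by omega), ih _ (by omega), ih _ (by omega)]
    simp

open Polynomial in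
/-- With `v = e^{-η} / t` the generating function `∑ R_p^k t^k = (cosh η + (t + t⁻¹) / 2) ^ p`
turns into `(sinh η * (1 + v) * (1 - y * (1 + v)) / v) ^ p`, where `y = (1 - coth η) / 2`. -/
theorem exp_mul_logPoly_eq_coeff {η : ℝ} (hη : 0 < η) (p : ℕ) : ∀ r : ℕ,
    Real.exp (((p : ℝ) - r) * η) * (logPoly p ((p : ℤ) - r)).eval (Real.cosh η)
      = Real.sinh η ^ p
        * (((1 + X) * (1 - C (legendreArg η) * (1 + X))) ^ p : ℝ[X]).coeff r := by
  set y := legendreArg η with hy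
  have h1 := sinh_mul_legendreArg hη
  have h2 := sinh_mul_one_sub_legendreArg hη
  have h3 : Real.cosh η = Real.sinh η * (1 - 2 * y) := by
    have := Real.cosh_sub_sinh η
    linarith
  set s := Real.sinh η
  set x := Real.cosh η
  induction p with
  | zero =>
    intro r
    rcases r with _ | r
    · simp [logPoly]
    · have : (-1 + -(r : ℤ)) ≠ 0 := by omega
      simp [logPoly, coeff_one, this]
  | succ p ih =>
    set q : ℝ[X] := (1 + X) * (1 - C y * (1 + X)) with hq
    have hq' : q = C (1 - y) + C (1 - 2 * y) * X - C y * (X * X) := by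
      rw [hq]
      simp only [C_sub, C_1, C_mul, show (2 : ℝ) = 1 + 1 by norm_num, C_add]
      ring
    have hmul : q ^ (p + 1)
        = C (1 - y) * q ^ p + C (1 - 2 * y) * (q ^ p * X) - C y * (q ^ p * X * X) := by
      rw [pow_succ]
      nth_rewrite 2 [hq']
      ring
    have hE : Real.exp η * Real.exp (-η) = 1 := by rw [← Real.exp_add]; simp
    have hrec : ∀ k : ℤ, (logPoly (p + 1) k).eval x
        = 1 / 2 * (logPoly p (k - 1)).eval x + x * (logPoly p k).eval x
          + 1 / 2 * (logPoly p (k + 1)).eval x := by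
      intro k
      simp [logPoly]
    intro r
    rw [hrec, hmul]
    rcases r with _ | _ | r
    · have a0 := ih 0
      have e : Real.exp (((p + 1 : ℕ) - (0 : ℕ) : ℝ) * η)
          = Real.exp η * Real.exp (((p : ℝ) - (0 : ℕ)) * η) := by
        rw [← Real.exp_add]; push_cast; ring_nf
      have i0 : ((p + 1 : ℕ) : ℤ) - (0 : ℕ) - 1 = (p : ℤ) - (0 : ℕ) := by push_cast; ring
      rw [e, i0, logPoly_eq_zero p (((p + 1 : ℕ) : ℤ) - (0 : ℕ)) (by push_cast; omega),
        logPoly_eq_zero p (_ + 1) (by push_cast; omega)]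
      simp only [coeff_sub, coeff_add, coeff_C_mul, coeff_mul_X_zero, eval_zero]
      rw [pow_succ]
      linear_combination (Real.exp η / 2) * a0 - s ^ p * (q ^ p).coeff 0 * h2
    · have a0 := ih 0
      have a1 := ih 1
      rw [logPoly_eq_zero p (_ + 1) (by push_cast; omega)]
      have e : Real.exp (((p + 1 : ℕ) - (0 + 1 : ℕ) : ℝ) * η)
          = Real.exp (((p : ℝ) - (0 : ℕ)) * η) := by
        push_cast; ring_nf
      have e1 : Real.exp (((p : ℝ) - (0 : ℕ)) * η)
          = Real.exp η * Real.exp (((p : ℝ) - (1 : ℕ)) * η) := by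
        rw [← Real.exp_add]; push_cast; ring_nf
      have i0 : ((p + 1 : ℕ) : ℤ) - (0 + 1 : ℕ) - 1 = (p : ℤ) - (1 : ℕ) := by push_cast; ring
      have i1 : ((p + 1 : ℕ) : ℤ) - (0 + 1 : ℕ) = (p : ℤ) - (0 : ℕ) := by push_cast; ring
      rw [e, i0, i1]
      simp only [coeff_sub, coeff_add, coeff_C_mul, coeff_mul_X_zero, coeff_mul_X, eval_zero,
        Nat.zero_add]
      rw [pow_succ]
      rw [e1] at a0 ⊢
      linear_combination (Real.exp η / 2) * a1 - s ^ p * (q ^ p).coeff 1 * h2 + x * a0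
        + s ^ p * (q ^ p).coeff 0 * h3
    · have a0 := ih r
      have a1 := ih (r + 1)
      have a2 := ih (r + 2)
      set F := Real.exp (((p : ℝ) - (r + 1 : ℕ)) * η)
      have e : Real.exp (((p + 1 : ℕ) - (r + 1 + 1 : ℕ) : ℝ) * η) = F := by
        change _ = Real.exp (((p : ℝ) - (r + 1 : ℕ)) * η)
        push_cast; ring_nf
      have e0 : Real.exp (((p : ℝ) - (r : ℕ)) * η) = Real.exp η * F := by
        change _ = _ * Real.exp (((p : ℝ) - (r + 1 : ℕ)) * η)
        rw [← Real.exp_add]; push_cast; ring_nf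
      have e2 : Real.exp (((p : ℝ) - (r + 2 : ℕ)) * η) = Real.exp (-η) * F := by
        change _ = _ * Real.exp (((p : ℝ) - (r + 1 : ℕ)) * η)
        rw [← Real.exp_add]; push_cast; ring_nf
      have i0 : ((p + 1 : ℕ) : ℤ) - (r + 1 + 1 : ℕ) - 1 = (p : ℤ) - (r + 2 : ℕ) := by
        push_cast; ring
      have i1 : ((p + 1 : ℕ) : ℤ) - (r + 1 + 1 : ℕ) = (p : ℤ) - (r + 1 : ℕ) := by push_cast; ring
      have i2 : (p : ℤ) - (r + 1 : ℕ) + 1 = (p : ℤ) - (r : ℕ) := by push_cast; ring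
      rw [e, i0, i1, i2]
      rw [e0] at a0
      rw [e2] at a2
      simp only [coeff_sub, coeff_add, coeff_C_mul, coeff_mul_X, Nat.add_assoc, Nat.reduceAdd]
      rw [pow_succ]
      linear_combination (Real.exp η / 2) * a2 - s ^ p * (q ^ p).coeff (r + 2) * h2 + x * a1
        + s ^ p * (q ^ p).coeff (r + 1) * h3 + (Real.exp (-η) / 2) * a0
        + s ^ p * (q ^ p).coeff r * h1
        - (1 / 2) * F * ((logPoly p ((p : ℤ) - (r + 2 : ℕ))).eval x
          + (logPoly p ((p : ℤ) - (r : ℕ))).eval x) * hE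

theorem exp_mul_logPoly_eq_sum {η : ℝ} (hη : 0 < η) (p r : ℕ) :
    Real.exp (((p : ℝ) - r) * η) * (logPoly p ((p : ℤ) - r)).eval (Real.cosh η)
      = Real.sinh η ^ p * ∑ j ∈ Finset.range (p + 1),
          (-1 : ℝ) ^ j * p.choose j * (p + j).choose r * legendreArg η ^ j := by
  rw [exp_mul_logPoly_eq_coeff hη]
  congr 1
  rw [mul_pow, sub_eq_neg_add,
    add_pow (-(Polynomial.C (legendreArg η) * (1 + Polynomial.X))) 1, Finset.mul_sum, Polynomial.finsetSum_coeff]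
  refine Finset.sum_congr rfl fun j _ => ?_
  have : (1 + Polynomial.X : Polynomial ℝ) ^ p
        * ((-(Polynomial.C (legendreArg η) * (1 + Polynomial.X))) ^ j * 1 ^ (p - j) * (p.choose j : Polynomial ℝ))
      = Polynomial.C ((-1) ^ j * p.choose j * legendreArg η ^ j)
          * (1 + Polynomial.X) ^ (p + j) := by
    rw [neg_pow, mul_pow]
    simp only [Polynomial.C_mul, Polynomial.C_pow, Polynomial.C_neg, Polynomial.C_1, map_natCast,
      pow_add]
    ring
  rw [this, Polynomial.coeff_C_mul, Polynomial.coeff_one_add_X_pow]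
  ring

theorem coth_add_one_div_coth_sub_one_rpow {η : ℝ} (hη : 0 < η) (μ : ℝ) :
    ((Real.cosh η / Real.sinh η + 1) / (Real.cosh η / Real.sinh η - 1)) ^ (μ / 2)
      = Real.exp (μ * η) := by
  have h : Real.sinh η ≠ 0 := (Real.sinh_pos_iff.2 hη).ne'
  have e : (Real.cosh η / Real.sinh η + 1) / (Real.cosh η / Real.sinh η - 1)
      = Real.exp (2 * η) := by
    have h1 := Real.cosh_sub_sinh η
    have h2 := Real.cosh_add_sinh η
    have h4 : Real.cosh η - Real.sinh η ≠ 0 := by rw [h1]; positivity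
    have h3 : Real.cosh η / Real.sinh η - 1 ≠ 0 := by
      rw [div_sub_one h]
      exact div_ne_zero h4 h
    rw [div_eq_iff h3, div_add_one h, div_sub_one h, h2, h1, ← mul_div_assoc, ← Real.exp_add]
    ring_nf
  rw [e, ← Real.exp_mul]
  ring_nf

theorem ascPochhammer_eval_neg_mul (p j : ℕ) :
    (ascPochhammer ℝ j).eval (-(p : ℝ)) * (ascPochhammer ℝ j).eval ((p : ℝ) + 1)
      = (-1) ^ j * factorialRatio p j := by
  induction j with
  | zero => simp [factorialRatio]
  | succ j ih =>
    rw [ascPochhammer_succ_eval, ascPochhammer_succ_eval, factorialRatio_succ_right, pow_succ]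
    linear_combination (-(p : ℝ) + j) * (p + 1 + j) * ih

/-- The Legendre function at `coth η` as a sum over any sufficiently long range. -/
theorem legendreP_coth {η : ℝ} (hη : 0 < η) (p : ℕ) (μ : ℤ) {m : ℕ} (hm : p < m) :
    legendreP p μ (Real.cosh η / Real.sinh η) = Real.exp (μ * η) *
      ∑ j ∈ Finset.range m, (-1 : ℝ) ^ j * factorialRatio p j
        / (j.factorial * Real.Gamma (1 - μ + j)) * legendreArg η ^ j := by
  rw [legendreP_eq_sum, coth_add_one_div_coth_sub_one_rpow hη]
  congr 1
  simp only [ascPochhammer_eval_neg_mul]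
  change _ = ∑ j ∈ Finset.range m, (-1 : ℝ) ^ j * factorialRatio p j
        / (j.factorial * Real.Gamma (1 - μ + j)) * ((1 - Real.cosh η / Real.sinh η) / 2) ^ j
  apply Finset.sum_subset
  · intro j hj
    simp only [Finset.mem_range] at hj ⊢
    omega
  · intro j _ hj
    simp only [Finset.mem_range, not_lt] at hj
    rw [factorialRatio_eq_zero (by omega)]
    simp

theorem factorialRatio_div_Gamma {p j : ℕ} (hj : j ≤ p) (r : ℕ) :
    p.factorial * (factorialRatio p j / (j.factorial * Real.Gamma ((p : ℝ) - r + 1 + j)))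
      = r.factorial * (p.choose j * (p + j).choose r) := by
  rw [factorialRatio_eq_div hj, Nat.cast_choose ℝ hj]
  rcases le_or_gt r (p + j) with h | h
  · have e : (p : ℝ) - r + 1 + j = ((p + j - r : ℕ) : ℝ) + 1 := by
      rw [Nat.cast_sub h]
      push_cast
      ring
    rw [e, Real.Gamma_nat_eq_factorial, Nat.cast_choose ℝ h]
    field_simp
  · have e : (p : ℝ) - r + 1 + j = -((r - (p + j) - 1 : ℕ) : ℝ) := by
      rw [Nat.cast_sub (by omega), Nat.cast_sub h.le]
      push_cast
      ring
    rw [e, Real.Gamma_neg_nat_eq_zero, Nat.choose_eq_zero_of_lt h]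
    simp

/-- Integer orders `μ = r - p ≥ -p`; the reciprocal Gamma values become binomial coefficients, which
vanish exactly where `Γ` has poles. -/
theorem factorial_mul_legendreP_coth {η : ℝ} (hη : 0 < η) (p r : ℕ) :
    p.factorial * legendreP p ((r : ℤ) - p) (Real.cosh η / Real.sinh η)
      = r.factorial * (Real.exp (((r : ℝ) - p) * η) * ∑ j ∈ Finset.range (p + 1),
          (-1 : ℝ) ^ j * p.choose j * (p + j).choose r * legendreArg η ^ j) := by
  rw [legendreP_coth hη p _ (Nat.lt_succ_self p), mul_left_comm (r.factorial : ℝ),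
    mul_left_comm (p.factorial : ℝ)]
  push_cast
  congr 1
  rw [Finset.mul_sum, Finset.mul_sum]
  refine Finset.sum_congr rfl fun j hj => ?_
  have hj' : j ≤ p := by
    rw [Finset.mem_range] at hj
    omega
  have := factorialRatio_div_Gamma hj' r
  rw [show (1 : ℝ) - ((r : ℝ) - p) + j = (p : ℝ) - r + 1 + j by ring]
  linear_combination (-1) ^ j * legendreArg η ^ j * this

/-- The logarithmic polynomials are Legendre functions of integer order. -/
theorem factorial_mul_logPoly_eval {η : ℝ} (hη : 0 < η) (p r : ℕ) :
    r.factorial * (logPoly p ((p : ℤ) - r)).eval (Real.cosh η)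
      = Real.sinh η ^ p * (p.factorial
          * legendreP p ((r : ℤ) - p) (Real.cosh η / Real.sinh η)) := by
  rw [factorial_mul_legendreP_coth hη]
  have h := exp_mul_logPoly_eq_sum hη p r
  have hE : Real.exp (((r : ℝ) - p) * η) * Real.exp (((p : ℝ) - r) * η) = 1 := by
    rw [← Real.exp_add]
    ring_nf
    simp
  linear_combination r.factorial * Real.exp (((r : ℝ) - p) * η) * h
    - r.factorial * (logPoly p ((p : ℤ) - r)).eval (Real.cosh η) * hE

/-- A consequence of `R_p^{-n} = R_p^n`. -/
theorem legendreP_neg_order {η : ℝ} (hη : 0 < η) {p n : ℕ} (hn : n ≤ p) :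
    legendreP p (-(n : ℤ)) (Real.cosh η / Real.sinh η)
      = ((p - n).factorial : ℝ) / (p + n).factorial
        * legendreP p n (Real.cosh η / Real.sinh η) := by
  have h1 := factorial_mul_logPoly_eval hη p (p - n)
  have h2 := factorial_mul_logPoly_eval hη p (p + n)
  rw [show (p : ℤ) - (p + n : ℕ) = -(n : ℤ) by push_cast; ring, logPoly_neg,
    show ((p + n : ℕ) : ℤ) - p = n by push_cast; ring] at h2
  rw [show (p : ℤ) - (p - n : ℕ) = n by omega,
    show ((p - n : ℕ) : ℤ) - p = -(n : ℤ) by omega] at h1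
  have hs : Real.sinh η ^ p * p.factorial ≠ 0 :=
    mul_ne_zero (pow_ne_zero _ (Real.sinh_pos_iff.2 hη).ne') (by positivity)
  have : ((p + n).factorial : ℝ) ≠ 0 := by positivity
  rw [div_mul_eq_mul_div, eq_div_iff this]
  apply mul_left_cancel₀ hs
  linear_combination (p - n).factorial * h2 - (p + n).factorial * h1

/-! ### Sums of logarithmic polynomials with a singular index -/

theorem sum_Icc_eq_sum_range_sub (a b : ℤ) (f : ℤ → ℝ) :
    ∑ k ∈ Finset.Icc a b, f k = ∑ l ∈ Finset.range (b + 1 - a).toNat, f (b - l) := by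
  refine Finset.sum_nbij' (fun k => (b - k).toNat) (fun l => b - l) ?_ ?_ ?_ ?_ ?_
  · intro k hk
    simp only [Finset.mem_Icc, Finset.mem_range] at hk ⊢
    omega
  · intro l hl
    simp only [Finset.mem_Icc, Finset.mem_range] at hl ⊢
    omega
  · intro k hk
    simp only [Finset.mem_Icc] at hk
    omega
  · intro l hl
    omega
  · intro k hk
    simp only [Finset.mem_Icc] at hk
    congr 1
    omega

theorem neg_one_zpow_sub (a b : ℕ) : (-1 : ℝ) ^ ((a : ℤ) - b) = (-1) ^ (a + b) := by
  rw [zpow_sub₀ (by norm_num), zpow_natCast, zpow_natCast, pow_add, div_eq_iff (by simp), mul_assoc,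
    ← mul_pow]
  simp

/-- The logarithmic sum at an index `p - D ∈ [-p, p]`, restricted to the summation indices below it.
Both sides are polynomials in `(1 - coth η) / 2` and are compared coefficientwise: every
coefficient on the left is a multiple of `H_{p+j} - H_D` by `sum_alternating_choose_add_div`, every
one on the right by `sum_factorialRatio_div`. -/
theorem sum_logPoly_div {η : ℝ} (hη : 0 < η) (p D : ℕ) (hD : D ≤ 2 * p) :
    ∑ k ∈ Finset.Icc (-(p : ℤ)) ((p : ℤ) - D - 1),
        (-1 : ℝ) ^ (k + 1) * Real.exp ((k : ℝ) * η) * (logPoly p k).eval (Real.cosh η)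
          / ((p : ℝ) - D - k)
      = p.factorial * Real.exp (((p : ℝ) - D) * η) * Real.sinh η ^ p
        * ((-1) ^ (p + D) / D.factorial)
        * (((harmonic (2 * p) : ℝ) - harmonic D)
            * legendreP p ((D : ℤ) - p) (Real.cosh η / Real.sinh η)
          + (-1) ^ p * ∑ k ∈ Finset.range p,
              (-1 : ℝ) ^ k * (2 * (k : ℝ) + 1) / (((p : ℝ) - k) * ((p : ℝ) + k + 1))
                * legendreP k ((D : ℤ) - p) (Real.cosh η / Real.sinh η)) := by
  set y := legendreArg η with hy
  set s := Real.sinh η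
  have hleft : ∑ k ∈ Finset.Icc (-(p : ℤ)) ((p : ℤ) - D - 1),
        (-1 : ℝ) ^ (k + 1) * Real.exp ((k : ℝ) * η) * (logPoly p k).eval (Real.cosh η)
          / ((p : ℝ) - D - k)
      = (-1) ^ (p + D) * s ^ p * ∑ j ∈ Finset.range (p + 1),
          (-1 : ℝ) ^ j * y ^ j * (p.choose j * (p + j).choose D)
            * ((harmonic (p + j) : ℝ) - harmonic D) := by
    rw [sum_Icc_eq_sum_range_sub,
      show ((p : ℤ) - D - 1 + 1 - -(p : ℤ)).toNat = 2 * p - D by omega]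
    have hterm : ∀ l ∈ Finset.range (2 * p - D),
        (-1 : ℝ) ^ ((p : ℤ) - D - 1 - l + 1) * Real.exp ((((p : ℤ) - D - 1 - l : ℤ) : ℝ) * η)
          * (logPoly p ((p : ℤ) - D - 1 - l)).eval (Real.cosh η)
          / ((p : ℝ) - D - (((p : ℤ) - D - 1 - l : ℤ) : ℝ))
        = (-1) ^ (p + D) * s ^ p * ∑ j ∈ Finset.range (p + 1), (-1 : ℝ) ^ j * y ^ j * p.choose j
            * ((-1) ^ l * ((p + j).choose (D + l + 1) : ℝ) / (l + 1)) := by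
      intro l _
      have h := exp_mul_logPoly_eq_sum hη p (D + l + 1)
      rw [show (p : ℤ) - D - 1 - l + 1 = (p : ℤ) - (D + l : ℕ) by push_cast; ring,
        neg_one_zpow_sub,
        show (p : ℤ) - D - 1 - l = (p : ℤ) - (D + l + 1 : ℕ) by push_cast; ring, mul_assoc,
        show (((p : ℤ) - (D + l + 1 : ℕ) : ℤ) : ℝ) = (p : ℝ) - (D + l + 1 : ℕ) by push_cast; ring,
        h, show (p : ℝ) - D - ((p : ℝ) - (D + l + 1 : ℕ)) = l + 1 by push_cast; ring,
        ← add_assoc, pow_add _ (p + D) l, Finset.mul_sum, Finset.mul_sum, Finset.sum_div,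
        Finset.mul_sum]
      refine Finset.sum_congr rfl fun j _ => ?_
      ring
    rw [Finset.sum_congr rfl hterm, ← Finset.mul_sum, Finset.sum_comm]
    congr 1
    refine Finset.sum_congr rfl fun j hj => ?_
    rw [Finset.mem_range] at hj
    rw [← Finset.mul_sum, sum_alternating_choose_add_div (p + j) D _ (by omega)]
    ring
  have hright : ((harmonic (2 * p) : ℝ) - harmonic D)
            * legendreP p ((D : ℤ) - p) (Real.cosh η / s)
          + (-1) ^ p * ∑ k ∈ Finset.range p,
              (-1 : ℝ) ^ k * (2 * (k : ℝ) + 1) / (((p : ℝ) - k) * ((p : ℝ) + k + 1))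
                * legendreP k ((D : ℤ) - p) (Real.cosh η / s)
      = Real.exp (((D : ℝ) - p) * η) * ∑ j ∈ Finset.range (p + 1),
          (-1 : ℝ) ^ j * y ^ j
            * (factorialRatio p j / (j.factorial * Real.Gamma ((p : ℝ) - D + 1 + j)))
            * ((harmonic (p + j) : ℝ) - harmonic D) := by
    have hP : ∀ k ∈ Finset.range (p + 1), legendreP k ((D : ℤ) - p) (Real.cosh η / s)
        = Real.exp (((D : ℝ) - p) * η) * ∑ j ∈ Finset.range (p + 1), (-1 : ℝ) ^ j
          * factorialRatio k j / (j.factorial * Real.Gamma ((p : ℝ) - D + 1 + j)) * y ^ j := by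
      intro k hk
      rw [legendreP_coth hη k _ (Finset.mem_range.1 hk)]
      push_cast
      simp only [show (1 : ℝ) - ((D : ℝ) - p) = (p : ℝ) - D + 1 by ring]
      rfl
    have hsum : ∑ k ∈ Finset.range p,
              (-1 : ℝ) ^ k * (2 * (k : ℝ) + 1) / (((p : ℝ) - k) * ((p : ℝ) + k + 1))
                * legendreP k ((D : ℤ) - p) (Real.cosh η / s)
        = Real.exp (((D : ℝ) - p) * η) * ∑ j ∈ Finset.range (p + 1),
            (-1 : ℝ) ^ j * y ^ j / (j.factorial * Real.Gamma ((p : ℝ) - D + 1 + j))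
            * ∑ k ∈ Finset.range p,
              (-1 : ℝ) ^ k * (2 * (k : ℝ) + 1) / (((p : ℝ) - k) * ((p : ℝ) + k + 1))
                * factorialRatio k j := by
      simp only [Finset.mul_sum]
      rw [Finset.sum_comm]
      refine Finset.sum_congr rfl fun k hk => ?_
      rw [Finset.mem_range] at hk
      rw [hP k (Finset.mem_range.2 (by omega)), Finset.mul_sum, Finset.mul_sum]
      refine Finset.sum_congr rfl fun j _ => ?_
      ring
    rw [hsum, hP p (Finset.self_mem_range_succ p), mul_left_comm, mul_left_comm ((-1 : ℝ) ^ p),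
      ← mul_add, Finset.mul_sum, Finset.mul_sum, ← Finset.sum_add_distrib]
    congr 1
    refine Finset.sum_congr rfl fun j hj => ?_
    rw [Finset.mem_range] at hj
    rw [mul_left_comm ((-1 : ℝ) ^ p), sum_factorialRatio_div p j (by omega)]
    ring
  rw [hleft, hright]
  have hE : Real.exp (((p : ℝ) - D) * η) * Real.exp (((D : ℝ) - p) * η) = 1 := by
    rw [← Real.exp_add]
    ring_nf
    simp
  have hj : ∀ j ∈ Finset.range (p + 1),
      (-1 : ℝ) ^ j * y ^ j * (p.choose j * (p + j).choose D)
            * ((harmonic (p + j) : ℝ) - harmonic D)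
      = p.factorial / D.factorial * ((-1 : ℝ) ^ j * y ^ j
            * (factorialRatio p j / (j.factorial * Real.Gamma ((p : ℝ) - D + 1 + j)))
            * ((harmonic (p + j) : ℝ) - harmonic D)) := by
    intro j hj
    rw [Finset.mem_range] at hj
    have h := factorialRatio_div_Gamma (show j ≤ p by omega) D
    have hD : (D.factorial : ℝ) ≠ 0 := by positivity
    rw [div_mul_eq_mul_div, eq_div_iff hD]
    linear_combination -((-1 : ℝ) ^ j * y ^ j * ((harmonic (p + j) : ℝ) - harmonic D)) * h
  rw [Finset.sum_congr rfl hj, ← Finset.mul_sum]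
  set T := ∑ j ∈ Finset.range (p + 1), (-1 : ℝ) ^ j * y ^ j
            * (factorialRatio p j / (j.factorial * Real.Gamma ((p : ℝ) - D + 1 + j)))
            * ((harmonic (p + j) : ℝ) - harmonic D)
  linear_combination (-(-1 : ℝ) ^ (p + D) * s ^ p * (p.factorial / D.factorial * T)) * hE

theorem realDigamma_natCast_add_one (n : ℕ) :
    realDigamma ((n : ℝ) + 1) = harmonic n - Real.eulerMascheroniConstant := by
  have h : ∀ n : ℕ, Complex.digamma ((n : ℂ) + 1)
      = ((harmonic n - Real.eulerMascheroniConstant : ℝ) : ℂ) := by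
    intro n
    induction n with
    | zero => simp [Complex.digamma_one]
    | succ n ih =>
      rw [Nat.cast_succ, Complex.digamma_apply_add_one, ih, harmonic_succ]
      · push_cast
        ring
      · intro m hm
        have : (n + 1 + m : ℕ) = (0 : ℂ) := by push_cast; linear_combination hm
        have := Nat.cast_eq_zero.1 this
        omega
  rw [realDigamma]
  push_cast
  rw [h, Complex.ofReal_re]

theorem legendreP_eq_zero_of_lt {η : ℝ} (hη : 0 < η) {k n : ℕ} (h : k < n) :
    legendreP k n (Real.cosh η / Real.sinh η) = 0 := by
  have h1 := factorial_mul_legendreP_coth hη k (k + n)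
  rw [Finset.sum_eq_zero, mul_zero, mul_zero] at h1
  · rw [show ((k + n : ℕ) : ℤ) - k = n by push_cast; ring] at h1
    exact (mul_eq_zero.1 h1).resolve_left (by positivity)
  · intro j hj
    rw [Finset.mem_range] at hj
    rw [Nat.choose_eq_zero_of_lt (n := k + j) (by omega)]
    simp

theorem sum_logPoly_div_zero {η : ℝ} (hη : 0 < η) (p : ℕ) :
    ∑ k ∈ Finset.Icc 1 p,
        (-1 : ℝ) ^ (k + 1) * Real.exp (-(k : ℝ) * η) * (logPoly p k).eval (Real.cosh η) / (k : ℝ)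
      = Real.sinh η ^ p * (realDigamma (2 * p + 1) - realDigamma (p + 1))
          * legendreP p 0 (Real.cosh η / Real.sinh η)
        + (-1 : ℝ) ^ p * Real.sinh η ^ p *
          ∑ k ∈ Finset.range p,
            (-1 : ℝ) ^ k * (2 * (k : ℝ) + 1) / (((p : ℝ) - k) * ((p : ℝ) + k + 1))
              * legendreP k 0 (Real.cosh η / Real.sinh η) := by
  have h := sum_logPoly_div hη p p (by omega)
  have e : ∑ k ∈ Finset.Icc 1 p,
        (-1 : ℝ) ^ (k + 1) * Real.exp (-(k : ℝ) * η) * (logPoly p k).eval (Real.cosh η) / (k : ℝ)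
      = ∑ k ∈ Finset.Icc (-(p : ℤ)) ((p : ℤ) - p - 1),
        (-1 : ℝ) ^ (k + 1) * Real.exp ((k : ℝ) * η) * (logPoly p k).eval (Real.cosh η)
          / ((p : ℝ) - p - k) := by
    refine Finset.sum_nbij' (fun k => -(k : ℤ)) (fun k => (-k).toNat) ?_ ?_ ?_ ?_ ?_
    · intro k hk
      simp only [Finset.mem_Icc] at hk ⊢
      omega
    · intro k hk
      simp only [Finset.mem_Icc] at hk ⊢
      omega
    · intro k hk
      omega
    · intro k hk
      simp only [Finset.mem_Icc] at hk
      omega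
    · intro k hk
      rw [logPoly_neg, show -(k : ℤ) + 1 = ((1 : ℕ) : ℤ) - k by push_cast; ring, neg_one_zpow_sub,
        add_comm 1 k]
      push_cast
      ring_nf
  have hd : realDigamma (2 * p + 1) = harmonic (2 * p) - Real.eulerMascheroniConstant := by
    rw [← realDigamma_natCast_add_one]
    push_cast
    rfl
  have hp : (p.factorial : ℝ) ≠ 0 := by positivity
  have h1 : (-1 : ℝ) ^ (p + p) = 1 := by rw [← two_mul, pow_mul]; simp
  rw [e, h, hd, realDigamma_natCast_add_one, h1, sub_self, sub_self, zero_mul, Real.exp_zero]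
  field_simp
  ring

theorem sum_logPoly_div_self {η : ℝ} (hη : 0 < η) (p : ℕ) :
    ∑ k ∈ Finset.Icc (-(p : ℤ)) ((p : ℤ) - 1),
        (-1 : ℝ) ^ (k + 1) * Real.exp ((k : ℝ) * η) * (logPoly p k).eval (Real.cosh η)
          / ((p : ℝ) - (k : ℝ))
      = (p.factorial : ℝ) * Real.exp ((p : ℝ) * η) * Real.sinh η ^ p *
        ((-1 : ℝ) ^ p / ((2 * p).factorial : ℝ) * (realDigamma (2 * p + 1) - realDigamma 1)
            * legendreP p p (Real.cosh η / Real.sinh η)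
          + ∑ k ∈ Finset.range p,
              (-1 : ℝ) ^ k * (2 * (k : ℝ) + 1) / (((p : ℝ) - k) * ((p : ℝ) + k + 1))
                * legendreP k (-(p : ℤ)) (Real.cosh η / Real.sinh η)) := by
  have h := sum_logPoly_div hη p 0 (by omega)
  have hd : realDigamma (2 * p + 1) = harmonic (2 * p) - Real.eulerMascheroniConstant := by
    rw [← realDigamma_natCast_add_one]
    push_cast
    rfl
  have hd1 : realDigamma 1 = -Real.eulerMascheroniConstant := by
    have := realDigamma_natCast_add_one 0
    simpa using this
  simp only [Nat.cast_zero, sub_zero, zero_sub] at h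
  rw [h, hd, hd1, legendreP_neg_order hη le_rfl, ← two_mul]
  have h1 : (-1 : ℝ) ^ p * (-1 : ℝ) ^ p = 1 := by rw [← mul_pow]; simp
  set S := ∑ k ∈ Finset.range p,
              (-1 : ℝ) ^ k * (2 * (k : ℝ) + 1) / (((p : ℝ) - k) * ((p : ℝ) + k + 1))
                * legendreP k (-(p : ℤ)) (Real.cosh η / Real.sinh η)
  simp only [Nat.add_zero, Nat.sub_self, Nat.factorial_zero, Nat.cast_one, div_one, harmonic_zero,
    Rat.cast_zero]
  linear_combination (p.factorial * Real.exp (p * η) * Real.sinh η ^ p * S) * h1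

/-- The two sums on the left are `sum_logPoly_div` at the indices `n` and `-n`. The factor
`1 + k! (p + n)! / ((2 n + k)! (p - n)!)` collects the Legendre functions of order `n` coming from
index `-n` and those of order `-n` and degree at least `n` coming from index `n`. -/
theorem sum_logPoly_div_of_lt {η : ℝ} (hη : 0 < η) (p n : ℕ) (hn : n + 1 ≤ p) :
    ∑ k ∈ Finset.Icc (-(p : ℤ)) ((n : ℤ) - 1),
          (-1 : ℝ) ^ (k + 1) * Real.exp ((k : ℝ) * η) * (logPoly p k).eval (Real.cosh η)
            / ((n : ℝ) - (k : ℝ))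
        + Real.exp (2 * (n : ℝ) * η) *
          ∑ k ∈ Finset.Icc (-(p : ℤ)) (-(n : ℤ) - 1),
            (-1 : ℝ) ^ k * Real.exp ((k : ℝ) * η) * (logPoly p k).eval (Real.cosh η)
              / ((n : ℝ) + (k : ℝ))
        = (p.factorial : ℝ) * Real.exp ((n : ℝ) * η) * Real.sinh η ^ p *
          ((-1 : ℝ) ^ n / ((p + n).factorial : ℝ)
              * (2 * realDigamma (2 * p + 1) - realDigamma (p + 1 + n) - realDigamma (p + 1 - n))
              * legendreP p n (Real.cosh η / Real.sinh η)
            + (-1 : ℝ) ^ p / ((p + n).factorial : ℝ) *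
              ∑ k ∈ Finset.range (p - n),
                (-1 : ℝ) ^ k * (2 * (n : ℝ) + 2 * k + 1)
                  * (1 + ((k.factorial : ℝ) * ((p + n).factorial : ℝ))
                      / (((2 * n + k).factorial : ℝ) * ((p - n).factorial : ℝ)))
                  / (((p : ℝ) - n - k) * ((p : ℝ) + n + k + 1))
                  * legendreP (n + k) n (Real.cosh η / Real.sinh η)
            + (-1 : ℝ) ^ (p + n) / ((p - n).factorial : ℝ) *
              ∑ k ∈ Finset.range n,
                (-1 : ℝ) ^ k * (2 * (k : ℝ) + 1) / (((p : ℝ) - k) * ((p : ℝ) + k + 1))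
                  * legendreP k (-(n : ℤ)) (Real.cosh η / Real.sinh η)) := by
  obtain ⟨d, rfl⟩ : ∃ d, p = n + d := ⟨p - n, by omega⟩
  have hm := sum_logPoly_div hη (n + d) d (by omega)
  have hp := sum_logPoly_div hη (n + d) (2 * n + d) (by omega)
  have hd : realDigamma (2 * (n + d : ℕ) + 1)
      = harmonic (2 * (n + d)) - Real.eulerMascheroniConstant := by
    rw [← realDigamma_natCast_add_one]
    push_cast
    rfl
  have hdp : realDigamma ((n + d : ℕ) + 1 + n)
      = harmonic (2 * n + d) - Real.eulerMascheroniConstant := by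
    rw [← realDigamma_natCast_add_one]
    push_cast
    ring_nf
  have hdm : realDigamma ((n + d : ℕ) + 1 - n)
      = harmonic d - Real.eulerMascheroniConstant := by
    rw [← realDigamma_natCast_add_one]
    push_cast
    ring_nf
  have hI : ((n + d : ℕ) : ℤ) - d = n := by push_cast; ring
  have hI' : ((d : ℕ) : ℤ) - (n + d : ℕ) = -n := by push_cast; ring
  have hR : ((n + d : ℕ) : ℝ) - d = n := by push_cast; ring
  have hJ : ((n + d : ℕ) : ℤ) - (2 * n + d : ℕ) = -n := by push_cast; ring
  have hJ' : ((2 * n + d : ℕ) : ℤ) - (n + d : ℕ) = n := by push_cast; ring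
  have hQ : ((n + d : ℕ) : ℝ) - (2 * n + d : ℕ) = -n := by push_cast; ring
  rw [hI, hR, hI'] at hm
  rw [hJ, hQ, hJ'] at hp
  have hflip : ∑ k ∈ Finset.Icc (-((n + d : ℕ) : ℤ)) (-(n : ℤ) - 1),
            (-1 : ℝ) ^ k * Real.exp ((k : ℝ) * η) * (logPoly (n + d) k).eval (Real.cosh η)
              / ((n : ℝ) + (k : ℝ))
      = ∑ k ∈ Finset.Icc (-((n + d : ℕ) : ℤ)) (-(n : ℤ) - 1),
            (-1 : ℝ) ^ (k + 1) * Real.exp ((k : ℝ) * η) * (logPoly (n + d) k).eval (Real.cosh η)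
              / (-(n : ℝ) - (k : ℝ)) := by
    refine Finset.sum_congr rfl fun k _ => ?_
    rw [zpow_add_one₀ (by norm_num), show -(n : ℝ) - k = -(n + k) by ring, div_neg]
    ring
  rw [hflip, hm, hp, hd, hdp, hdm, show n + d - n = d by omega,
    show n + d + n = 2 * n + d by ring]
  set z := Real.cosh η / Real.sinh η
  have hE : Real.exp (2 * n * η) * Real.exp (-n * η) = Real.exp (n * η) := by
    rw [← Real.exp_add]
    ring_nf
  -- the summands of index `< n` vanish for order `n`, the others have the same sign of the order
  have hSp : ∑ k ∈ Finset.range (n + d),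
        (-1 : ℝ) ^ k * (2 * (k : ℝ) + 1) / ((((n + d : ℕ) : ℝ) - k) * (((n + d : ℕ) : ℝ) + k + 1))
          * legendreP k n z
      = (-1) ^ n * ∑ k ∈ Finset.range d, (-1 : ℝ) ^ k * (2 * (n : ℝ) + 2 * k + 1)
          / ((((n + d : ℕ) : ℝ) - n - k) * (((n + d : ℕ) : ℝ) + n + k + 1))
          * legendreP (n + k) n z := by
    rw [Finset.sum_range_add, Finset.sum_eq_zero, zero_add, Finset.mul_sum]
    · refine Finset.sum_congr rfl fun k _ => ?_
      rw [pow_add]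
      push_cast
      ring
    · intro k hk
      rw [legendreP_eq_zero_of_lt hη (Finset.mem_range.1 hk), mul_zero]
  have hSm : ∑ k ∈ Finset.range (n + d),
        (-1 : ℝ) ^ k * (2 * (k : ℝ) + 1) / ((((n + d : ℕ) : ℝ) - k) * (((n + d : ℕ) : ℝ) + k + 1))
          * legendreP k (-(n : ℤ)) z
      = ∑ k ∈ Finset.range n,
          (-1 : ℝ) ^ k * (2 * (k : ℝ) + 1)
            / ((((n + d : ℕ) : ℝ) - k) * (((n + d : ℕ) : ℝ) + k + 1)) * legendreP k (-(n : ℤ)) z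
        + (-1) ^ n * ∑ k ∈ Finset.range d, (-1 : ℝ) ^ k * (2 * (n : ℝ) + 2 * k + 1)
          / ((((n + d : ℕ) : ℝ) - n - k) * (((n + d : ℕ) : ℝ) + n + k + 1))
          * ((k.factorial : ℝ) / (2 * n + k).factorial * legendreP (n + k) n z) := by
    rw [Finset.sum_range_add, Finset.mul_sum]
    congr 1
    refine Finset.sum_congr rfl fun k _ => ?_
    rw [legendreP_neg_order hη (Nat.le_add_right n k), pow_add, Nat.add_sub_cancel_left,
      show n + k + n = 2 * n + k by ring]
    push_cast
    ring
  have hmid : ∑ k ∈ Finset.range d,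
        (-1 : ℝ) ^ k * (2 * (n : ℝ) + 2 * k + 1)
          * (1 + ((k.factorial : ℝ) * ((2 * n + d).factorial : ℝ))
              / (((2 * n + k).factorial : ℝ) * (d.factorial : ℝ)))
          / ((((n + d : ℕ) : ℝ) - n - k) * (((n + d : ℕ) : ℝ) + n + k + 1))
          * legendreP (n + k) n z
      = ∑ k ∈ Finset.range d, (-1 : ℝ) ^ k * (2 * (n : ℝ) + 2 * k + 1)
          / ((((n + d : ℕ) : ℝ) - n - k) * (((n + d : ℕ) : ℝ) + n + k + 1))
          * legendreP (n + k) n z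
        + (2 * n + d).factorial / d.factorial * ∑ k ∈ Finset.range d,
          (-1 : ℝ) ^ k * (2 * (n : ℝ) + 2 * k + 1)
          / ((((n + d : ℕ) : ℝ) - n - k) * (((n + d : ℕ) : ℝ) + n + k + 1))
          * ((k.factorial : ℝ) / (2 * n + k).factorial * legendreP (n + k) n z) := by
    rw [Finset.mul_sum, ← Finset.sum_add_distrib]
    refine Finset.sum_congr rfl fun k _ => ?_
    generalize (((n + d : ℕ) : ℝ) - n - k) * (((n + d : ℕ) : ℝ) + n + k + 1) = Q
    ring
  rw [hSp, hSm, hmid, legendreP_neg_order hη (Nat.le_add_right n d), Nat.add_sub_cancel_left,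
    show n + d + n = 2 * n + d by ring]
  set A := ∑ k ∈ Finset.range d, (-1 : ℝ) ^ k * (2 * (n : ℝ) + 2 * k + 1)
          / ((((n + d : ℕ) : ℝ) - n - k) * (((n + d : ℕ) : ℝ) + n + k + 1))
          * legendreP (n + k) n z
  set B := ∑ k ∈ Finset.range d, (-1 : ℝ) ^ k * (2 * (n : ℝ) + 2 * k + 1)
          / ((((n + d : ℕ) : ℝ) - n - k) * (((n + d : ℕ) : ℝ) + n + k + 1))
          * ((k.factorial : ℝ) / (2 * n + k).factorial * legendreP (n + k) n z)
  set G := ∑ k ∈ Finset.range n,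
          (-1 : ℝ) ^ k * (2 * (k : ℝ) + 1)
            / ((((n + d : ℕ) : ℝ) - k) * (((n + d : ℕ) : ℝ) + k + 1)) * legendreP k (-(n : ℤ)) z
  have h1 : (-1 : ℝ) ^ (n + d + d) = (-1) ^ n := by
    rw [add_assoc, ← two_mul, pow_add, pow_mul]
    simp
  have h2 : (-1 : ℝ) ^ (n + d + (2 * n + d)) = (-1) ^ n := by
    rw [show n + d + (2 * n + d) = n + 2 * (n + d) by ring, pow_add, pow_mul]
    simp
  have h3 : (-1 : ℝ) ^ (2 * n + d) = (-1) ^ d := by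
    rw [pow_add, pow_mul]
    simp
  have h4 : (-1 : ℝ) ^ n * (-1) ^ n = 1 := by rw [← mul_pow]; simp
  have h5 : (-1 : ℝ) ^ (n + d) = (-1) ^ n * (-1) ^ d := pow_add _ _ _
  rw [h1, h2, h3, h5]
  have f1 : ((2 * n + d).factorial : ℝ) * ((2 * n + d).factorial : ℝ)⁻¹ = 1 :=
    mul_inv_cancel₀ (by positivity)
  have f2 : (d.factorial : ℝ) * (d.factorial : ℝ)⁻¹ = 1 := mul_inv_cancel₀ (by positivity)
  set P := legendreP (n + d) n z
  set c := ((n + d).factorial : ℝ) * Real.sinh η ^ (n + d) with hc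
  set b : ℝ := (-1) ^ n
  set u : ℝ := (-1) ^ d
  set Hp := (harmonic (2 * (n + d)) : ℝ)
  linear_combination c * b * ((2 * n + d).factorial : ℝ)⁻¹
      * ((Hp - harmonic (2 * n + d)) * P + b * u * (b * A)) * hE
    + c * Real.exp (n * η) * u * ((d.factorial : ℝ)⁻¹ * G + b * (d.factorial : ℝ)⁻¹ * B
      + b * ((2 * n + d).factorial : ℝ)⁻¹ * A) * h4
    + c * Real.exp (n * η) * b * (Hp - harmonic d) * P * ((2 * n + d).factorial : ℝ)⁻¹ * f2
    - c * Real.exp (n * η) * b * u * (d.factorial : ℝ)⁻¹ * B * f1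

/-! ### The ending function -/

theorem prod_erase_eq_prod_ite {ι : Type*} [DecidableEq ι] (s : Finset ι) (a : ι) (f : ι → ℝ) :
    ∏ i ∈ s.erase a, f i = ∏ i ∈ s, if i = a then 1 else f i := by
  rw [← Finset.prod_erase s (a := a) (f := fun i => if i = a then 1 else f i) (by simp)]
  refine Finset.prod_congr rfl fun i hi => ?_
  rw [if_neg (Finset.ne_of_mem_erase hi)]

theorem prod_range_succ_erase {N r : ℕ} (hr : r ≠ N) (u : ℝ) :
    ∏ i ∈ (Finset.range (N + 1)).erase r, (u + i)
      = (∏ i ∈ (Finset.range N).erase r, (u + i)) * (u + N) := by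
  rw [prod_erase_eq_prod_ite, prod_erase_eq_prod_ite, Finset.prod_range_succ, if_neg hr.symm]

theorem prod_range_succ_erase_succ (N r : ℕ) (u : ℝ) :
    ∏ i ∈ (Finset.range (N + 1)).erase (r + 1), (u + i)
      = (∏ i ∈ (Finset.range N).erase r, (u + 1 + i)) * u := by
  rw [prod_erase_eq_prod_ite, prod_erase_eq_prod_ite, Finset.prod_range_succ']
  congr 1
  · refine Finset.prod_congr rfl fun i _ => ?_
    simp only [Nat.succ_inj]
    push_cast
    ring_nf
  · simp

/-- The partial fraction decomposition of `N! / (u (u + 1) ⋯ (u + N))`, cleared of its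
denominators. -/
theorem sum_choose_mul_prod_erase (N : ℕ) : ∀ u : ℝ,
    ∑ r ∈ Finset.range (N + 1), (-1 : ℝ) ^ r * N.choose r
        * ∏ i ∈ (Finset.range (N + 1)).erase r, (u + i) = N.factorial := by
  induction N with
  | zero => intro u; simp
  | succ N ih =>
    intro u
    have h1 : ∑ r ∈ Finset.range (N + 1), (-1 : ℝ) ^ r * N.choose r
        * ∏ i ∈ (Finset.range (N + 1 + 1)).erase r, (u + i)
        = (u + N + 1) * N.factorial := by
      rw [← ih u, Finset.mul_sum]
      refine Finset.sum_congr rfl fun r hr => ?_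
      rw [prod_range_succ_erase (Finset.mem_range.1 hr).ne]
      push_cast
      ring
    have h2 : ∑ r ∈ Finset.range (N + 1), (-1 : ℝ) ^ r * N.choose r
        * ∏ i ∈ (Finset.range (N + 1 + 1)).erase (r + 1), (u + i) = u * N.factorial := by
      rw [← ih (u + 1), Finset.mul_sum]
      refine Finset.sum_congr rfl fun r _ => ?_
      rw [prod_range_succ_erase_succ]
      ring
    rw [Finset.sum_range_succ'] at h1 ⊢
    have h3 : ∑ r ∈ Finset.range (N + 1), (-1 : ℝ) ^ (r + 1) * (N + 1).choose (r + 1)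
          * ∏ i ∈ (Finset.range (N + 1 + 1)).erase (r + 1), (u + i)
        = ∑ r ∈ Finset.range N, (-1 : ℝ) ^ (r + 1) * N.choose (r + 1)
            * ∏ i ∈ (Finset.range (N + 1 + 1)).erase (r + 1), (u + i)
          - ∑ r ∈ Finset.range (N + 1), (-1 : ℝ) ^ r * N.choose r
            * ∏ i ∈ (Finset.range (N + 1 + 1)).erase (r + 1), (u + i) := by
      have h4 : ∑ r ∈ Finset.range N, (-1 : ℝ) ^ (r + 1) * N.choose (r + 1)
            * ∏ i ∈ (Finset.range (N + 1 + 1)).erase (r + 1), (u + i)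
          = ∑ r ∈ Finset.range (N + 1), (-1 : ℝ) ^ (r + 1) * N.choose (r + 1)
            * ∏ i ∈ (Finset.range (N + 1 + 1)).erase (r + 1), (u + i) := by
        rw [Finset.sum_range_succ]
        simp
      rw [h4, ← Finset.sum_sub_distrib]
      refine Finset.sum_congr rfl fun r _ => ?_
      rw [Nat.choose_succ_succ']
      push_cast
      ring
    rw [h3, h2, Nat.factorial_succ]
    simp only [Nat.choose_zero_right] at h1 ⊢
    push_cast
    linear_combination h1

theorem sum_choose_mul_prod_erase_of_le {N M : ℕ} (h : N ≤ M) (u : ℝ) :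
    ∑ r ∈ Finset.range (M + 1), (-1 : ℝ) ^ r * N.choose r
        * ∏ i ∈ (Finset.range (M + 1)).erase r, (u + i)
      = N.factorial * ∏ i ∈ Finset.Ico (N + 1) (M + 1), (u + i) := by
  induction M, h using Nat.le_induction with
  | base => simp [sum_choose_mul_prod_erase]
  | succ M hM ih =>
    rw [Finset.sum_range_succ, Nat.choose_eq_zero_of_lt (by omega),
      Finset.prod_Ico_succ_top (by omega), ← mul_assoc, ← ih, Finset.sum_mul]
    simp only [Nat.cast_zero, mul_zero, zero_mul, add_zero]
    refine Finset.sum_congr rfl fun r hr => ?_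
    rw [prod_range_succ_erase (Finset.mem_range.1 hr).ne]
    ring

theorem factorial_mul_prod_Ico {j m : ℕ} (h : j ≤ m) (n a : ℕ) :
    ((n + j).factorial : ℝ) * ∏ i ∈ Finset.Ico (a + j + 1) (a + m + 1), ((n : ℝ) - a + i)
      = (n + m).factorial := by
  induction m, h using Nat.le_induction with
  | base => simp
  | succ m hm ih =>
    rw [← add_assoc a m 1, Finset.prod_Ico_succ_top (by omega), ← mul_assoc, ih, ← add_assoc,
      Nat.factorial_succ]
    push_cast
    ring

theorem expArcosh_cosh {η : ℝ} (hη : 0 < η) : expArcosh (Real.cosh η) = Real.exp η := by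
  have h : Real.cosh η ^ 2 - 1 = Real.sinh η ^ 2 := by
    have := Real.cosh_sq η
    linarith
  rw [expArcosh, h, Real.sqrt_sq (Real.sinh_pos_iff.2 hη).le, Real.cosh_add_sinh]

theorem expArcosh_cosh_zpow {η : ℝ} (hη : 0 < η) (k : ℤ) :
    expArcosh (Real.cosh η) ^ k = Real.exp (k * η) := by
  rw [expArcosh_cosh hη, ← Real.rpow_intCast, ← Real.exp_mul, mul_comm]

theorem prod_Icc_erase_sub (p r : ℕ) (t : ℝ) :
    ∏ j ∈ (Finset.Icc (-(p : ℤ)) (p : ℤ)).erase ((p : ℤ) - r), (t - j)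
      = ∏ i ∈ (Finset.range (2 * p + 1)).erase r, (t - p + i) := by
  refine Finset.prod_nbij' (fun j => ((p : ℤ) - j).toNat) (fun i => (p : ℤ) - i) ?_ ?_ ?_ ?_ ?_
  · intro j hj
    simp only [Finset.mem_erase, Finset.mem_Icc, Finset.mem_range] at hj ⊢
    omega
  · intro i hi
    simp only [Finset.mem_erase, Finset.mem_Icc, Finset.mem_range] at hi ⊢
    omega
  · intro j hj
    simp only [Finset.mem_erase, Finset.mem_Icc] at hj
    omega
  · intro i hi
    omega
  · intro j hj
    simp only [Finset.mem_erase, Finset.mem_Icc] at hj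
    have : ((((p : ℤ) - j).toNat : ℤ) : ℝ) = ((p : ℤ) - j : ℤ) := by
      rw [Int.toNat_of_nonneg (by omega)]
    push_cast at this
    rw [this]
    ring

theorem endingFun_cosh_eq_sum {η : ℝ} (hη : 0 < η) (p n : ℕ) :
    endingFun n p (Real.cosh η)
      = 2 * (-1) ^ (p + 1) * Real.sinh η ^ p * ∑ j ∈ Finset.range (p + 1), (-1 : ℝ) ^ j
          * p.choose j * ((p + j).factorial * (n + p).factorial / (n + j).factorial)
          * legendreArg η ^ j := by
  set y := legendreArg η
  set s := Real.sinh η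
  have hterm : ∀ r ∈ Finset.range (2 * p + 1),
      (-1 : ℝ) ^ ((p : ℤ) - r + 1) * expArcosh (Real.cosh η) ^ ((p : ℤ) - r)
          * (logPoly p ((p : ℤ) - r)).eval (Real.cosh η)
          * ∏ j ∈ (Finset.Icc (-(p : ℤ)) (p : ℤ)).erase ((p : ℤ) - r), ((n : ℝ) - j)
        = (-1) ^ (p + 1) * s ^ p * ∑ j ∈ Finset.range (p + 1), (-1 : ℝ) ^ j * p.choose j * y ^ j
            * ((-1) ^ r * (p + j).choose r
              * ∏ i ∈ (Finset.range (2 * p + 1)).erase r, ((n : ℝ) - p + i)) := by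
    intro r _
    have h := exp_mul_logPoly_eq_sum hη p r
    rw [prod_Icc_erase_sub, expArcosh_cosh_zpow hη,
      show (p : ℤ) - r + 1 = ((p + 1 : ℕ) : ℤ) - r by push_cast; ring, neg_one_zpow_sub,
      mul_assoc ((-1 : ℝ) ^ (p + 1 + r)),
      show (((p : ℤ) - r : ℤ) : ℝ) = (p : ℝ) - r by push_cast; ring, h, pow_add _ (p + 1) r,
      Finset.mul_sum, Finset.mul_sum, Finset.sum_mul, Finset.mul_sum]
    refine Finset.sum_congr rfl fun j _ => ?_
    ring
  rw [endingFun, sum_Icc_eq_sum_range_sub,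
    show ((p : ℤ) + 1 - -(p : ℤ)).toNat = 2 * p + 1 by omega, Finset.sum_congr rfl hterm,
    ← Finset.mul_sum, Finset.sum_comm, mul_assoc 2, mul_assoc 2]
  congr 2
  refine Finset.sum_congr rfl fun j hj => ?_
  rw [Finset.mem_range] at hj
  rw [← Finset.mul_sum, sum_choose_mul_prod_erase_of_le (by omega : p + j ≤ 2 * p)]
  have h := factorial_mul_prod_Ico (show j ≤ p by omega) n p
  rw [← two_mul] at h
  rw [← h]
  have : ((n + j).factorial : ℝ) ≠ 0 := by positivity
  field_simp

theorem legendreP_neg_natCast_coth {η : ℝ} (hη : 0 < η) (p n : ℕ) :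
    p.factorial * (Real.exp (n * η) * legendreP p (-(n : ℤ)) (Real.cosh η / Real.sinh η))
      = ∑ j ∈ Finset.range (p + 1), (-1 : ℝ) ^ j
          * p.choose j * ((p + j).factorial / (n + j).factorial) * legendreArg η ^ j := by
  rw [legendreP_coth hη p _ (Nat.lt_succ_self p), ← mul_assoc (Real.exp _), ← Real.exp_add]
  push_cast
  rw [show (n : ℝ) * η + -n * η = 0 by ring, Real.exp_zero, one_mul, Finset.mul_sum]
  refine Finset.sum_congr rfl fun j hj => ?_
  rw [Finset.mem_range] at hj
  rw [show (1 : ℝ) - -n + j = ((n + j : ℕ) : ℝ) + 1 by push_cast; ring,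
    Real.Gamma_nat_eq_factorial, factorialRatio_eq_div (by omega),
    Nat.cast_choose ℝ (show j ≤ p by omega)]
  field_simp

theorem endingFun_cosh_eq_legendreP {η : ℝ} (hη : 0 < η) (p n : ℕ) :
    endingFun n p (Real.cosh η)
        = 2 * (-1 : ℝ) ^ (p + 1) * (p.factorial : ℝ) * ((p + n).factorial : ℝ)
            * Real.exp ((n : ℝ) * η) * Real.sinh η ^ p
            * legendreP p (-(n : ℤ)) (Real.cosh η / Real.sinh η) := by
  have h := legendreP_neg_natCast_coth hη p n
  have e : ∑ j ∈ Finset.range (p + 1), (-1 : ℝ) ^ j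
          * p.choose j * ((p + j).factorial * (n + p).factorial / (n + j).factorial)
          * legendreArg η ^ j
      = (n + p).factorial * ∑ j ∈ Finset.range (p + 1), (-1 : ℝ) ^ j
          * p.choose j * ((p + j).factorial / (n + j).factorial) * legendreArg η ^ j := by
    rw [Finset.mul_sum]
    refine Finset.sum_congr rfl fun j _ => ?_
    ring
  rw [endingFun_cosh_eq_sum hη, e, ← h, add_comm n p]
  ring

theorem endingFun_eq_mul_logSum {p n : ℕ} (h : p + 1 ≤ n) (x : ℝ) :
    endingFun n p x = ((n + p).factorial : ℝ) / ((n - p - 1).factorial : ℝ)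
      * logSum n p (-(p : ℤ)) p x := by
  obtain ⟨q, rfl⟩ : ∃ q, n = p + 1 + q := ⟨n - (p + 1), by omega⟩
  rw [show p + 1 + q - p - 1 = q by omega]
  have hprod : ∏ j ∈ Finset.Icc (-(p : ℤ)) (p : ℤ), (((p + 1 + q : ℕ) : ℝ) - j)
      = ((p + 1 + q + p).factorial : ℝ) / q.factorial := by
    have h1 := prod_Icc_erase_sub p (2 * p + 1) ((p + 1 + q : ℕ) : ℝ)
    rw [Finset.erase_eq_of_notMem (by simp only [Finset.mem_Icc]; omega),
      Finset.erase_eq_of_notMem (by simp)] at h1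
    have h2 := Nat.factorial_mul_ascFactorial q (2 * p + 1)
    rw [Nat.ascFactorial_eq_prod_range, show q + (2 * p + 1) = p + 1 + q + p by ring] at h2
    rw [h1, ← h2, eq_div_iff (by positivity)]
    push_cast
    rw [mul_comm]
    congr 1
    refine Finset.prod_congr rfl fun i _ => ?_
    ring
  rw [endingFun, logSum, mul_left_comm, ← hprod]
  congr 1
  rw [Finset.mul_sum]
  refine Finset.sum_congr rfl fun k hk => ?_
  rw [← Finset.mul_prod_erase _ _ hk]
  have hk' : ((p + 1 + q : ℕ) : ℝ) - k ≠ 0 := by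
    rw [Finset.mem_Icc] at hk
    have : (((p + 1 + q : ℕ) : ℤ) - k : ℤ) ≠ 0 := by push_cast; omega
    exact_mod_cast this
  push_cast at hk' ⊢
  field_simp

theorem sum_logPoly_div_of_gt {η : ℝ} (hη : 0 < η) {p n : ℕ} (h : p + 1 ≤ n) :
    ∑ k ∈ Finset.Icc (-(p : ℤ)) (p : ℤ),
          (-1 : ℝ) ^ (k + 1) * Real.exp ((k : ℝ) * η) * (logPoly p k).eval (Real.cosh η)
            / ((n : ℝ) - (k : ℝ))
        = (-1 : ℝ) ^ (p + 1) * (p.factorial : ℝ) * ((n - p - 1).factorial : ℝ)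
            * Real.exp ((n : ℝ) * η) * Real.sinh η ^ p
            * legendreP p (-(n : ℤ)) (Real.cosh η / Real.sinh η) := by
  have h1 := endingFun_cosh_eq_legendreP hη p n
  rw [endingFun_eq_mul_logSum h, logSum, add_comm n p, div_mul_eq_mul_div,
    div_eq_iff (by positivity)] at h1
  simp only [expArcosh_cosh_zpow hη, Int.cast_natCast] at h1
  have h2 : (2 * (p + n).factorial : ℝ) ≠ 0 := by positivity
  apply mul_left_cancel₀ h2
  linear_combination h1

/-! ### Fourier coefficients of inverse powers -/

/-- The polynomial in `y` and `n` for which `e^{-nη} * inversePowerCoeff p (legendreArg η) n` is,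
up to the factor `sinh η ^ (p + 1)`, the `n`-th Fourier coefficient of
`(cosh η - cos ψ)⁻¹ ^ (p + 1)`. -/
noncomputable def inversePowerCoeff (p : ℕ) (y : ℝ) (n : ℕ) : ℝ :=
  ∑ j ∈ Finset.range (p + 1), (-1 : ℝ) ^ j * (p + n).choose (p - j) * (p + j).choose j * y ^ j

theorem inversePowerCoeff_succ_sub (p : ℕ) (y : ℝ) (n : ℕ) :
    inversePowerCoeff (p + 1) y (n + 1) - inversePowerCoeff (p + 1) y n
      = ∑ j ∈ Finset.range (p + 1),
          (-1 : ℝ) ^ j * (p + 1 + n).choose (p - j) * (p + 1 + j).choose j * y ^ j := by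
  rw [inversePowerCoeff, inversePowerCoeff, ← Finset.sum_sub_distrib, Finset.sum_range_succ]
  simp only [Nat.sub_self, Nat.choose_zero_right, sub_self, add_zero]
  refine Finset.sum_congr rfl fun j hj => ?_
  rw [Finset.mem_range] at hj
  rw [show p + 1 - j = p - j + 1 by omega, show p + 1 + (n + 1) = p + 1 + n + 1 by ring,
    Nat.choose_succ_succ']
  push_cast
  ring

theorem inversePowerCoeff_recurrence (p : ℕ) (y : ℝ) (n : ℕ) :
    (1 - y) * (inversePowerCoeff (p + 1) y (n + 1) - inversePowerCoeff (p + 1) y n)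
      + y * (inversePowerCoeff (p + 1) y (n + 2) - inversePowerCoeff (p + 1) y (n + 1))
      = inversePowerCoeff p y (n + 1) := by
  have h1 := inversePowerCoeff_succ_sub p y n
  have h2 := inversePowerCoeff_succ_sub p y (n + 1)
  have h3 : ∑ j ∈ Finset.range (p + 1),
          (-1 : ℝ) ^ j * (p + 1 + (n + 1)).choose (p - j) * (p + 1 + j).choose j * y ^ j
      - ∑ j ∈ Finset.range (p + 1),
          (-1 : ℝ) ^ j * (p + 1 + n).choose (p - j) * (p + 1 + j).choose j * y ^ j
      = ∑ j ∈ Finset.range p,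
          (-1 : ℝ) ^ j * (p + 1 + n).choose (p - (j + 1)) * (p + 1 + j).choose j * y ^ j := by
    rw [← Finset.sum_sub_distrib, Finset.sum_range_succ]
    simp only [Nat.sub_self, Nat.choose_zero_right, sub_self, add_zero]
    refine Finset.sum_congr rfl fun j hj => ?_
    rw [Finset.mem_range] at hj
    rw [show p - j = p - (j + 1) + 1 by omega, show p + 1 + (n + 1) = p + 1 + n + 1 by ring,
      Nat.choose_succ_succ']
    push_cast
    ring
  have h4 : ∑ j ∈ Finset.range (p + 1),
          (-1 : ℝ) ^ j * (p + 1 + n).choose (p - j) * (p + 1 + j).choose j * y ^ j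
      - inversePowerCoeff p y (n + 1)
      = -y * ∑ j ∈ Finset.range p,
          (-1 : ℝ) ^ j * (p + 1 + n).choose (p - (j + 1)) * (p + 1 + j).choose j * y ^ j := by
    rw [inversePowerCoeff, ← Finset.sum_sub_distrib, Finset.sum_range_succ', Finset.mul_sum]
    simp only [show p + (n + 1) = p + 1 + n by ring, Nat.choose_zero_right, sub_self, add_zero]
    refine Finset.sum_congr rfl fun j _ => ?_
    rw [show p + 1 + (j + 1) = p + 1 + j + 1 by ring, Nat.choose_succ_succ' (p + 1 + j) j,
      show p + (j + 1) = p + 1 + j by ring]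
    push_cast
    ring
  linear_combination (1 - y) * h1 + y * h2 + y * h3 + h4

/-- The recurrence at index `0`, where evenness identifies the coefficients of index `-1` and `1`. -/
theorem inversePowerCoeff_recurrence_zero (p : ℕ) (y : ℝ) :
    inversePowerCoeff (p + 1) y 0
      + 2 * y * (inversePowerCoeff (p + 1) y 1 - inversePowerCoeff (p + 1) y 0)
      = inversePowerCoeff p y 0 := by
  have h0 : inversePowerCoeff p y 0 = ∑ j ∈ Finset.range (p + 2),
      (-1 : ℝ) ^ j * p.choose j * (p + j).choose j * y ^ j := by
    rw [Finset.sum_range_succ, Nat.choose_succ_self, inversePowerCoeff]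
    simp only [Nat.cast_zero, mul_zero, zero_mul, add_zero]
    refine Finset.sum_congr rfl fun j hj => ?_
    rw [Finset.mem_range] at hj
    rw [Nat.choose_symm (by omega)]
  have h1 : inversePowerCoeff (p + 1) y 0 = ∑ j ∈ Finset.range (p + 2),
      (-1 : ℝ) ^ j * (p + 1).choose j * (p + 1 + j).choose j * y ^ j := by
    rw [inversePowerCoeff]
    refine Finset.sum_congr rfl fun j hj => ?_
    rw [Finset.mem_range] at hj
    rw [add_zero, Nat.choose_symm (by omega)]
  rw [inversePowerCoeff_succ_sub, h0, h1, Finset.sum_range_succ' _ (p + 1),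
    Finset.sum_range_succ' _ (p + 1), Finset.mul_sum, add_right_comm, ← Finset.sum_add_distrib]
  simp only [Nat.choose_zero_right]
  congr 1
  refine Finset.sum_congr rfl fun i hi => ?_
  rw [Finset.mem_range] at hi
  have e1 : (p + 1).choose (p - i) = (p + 1).choose (i + 1) := by
    rw [← Nat.choose_symm (by omega : i + 1 ≤ p + 1)]
    congr 1
    omega
  have e2 : ((p.choose (i + 1) : ℕ) : ℝ) * (p + 1) = (p + 1).choose (i + 1) * (p - i) := by
    have := Nat.choose_mul_succ_eq p (i + 1)
    rw [show p + 1 - (i + 1) = p - i by omega] at this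
    rw [← Nat.cast_sub (by omega : i ≤ p)]
    exact_mod_cast this
  have e3 : (((p + 1 + i).choose (i + 1) : ℕ) : ℝ) * (i + 1) = (p + 1 + i).choose i * (p + 1) := by
    have := Nat.choose_succ_right_eq (p + 1 + i) i
    rw [show p + 1 + i - i = p + 1 by omega] at this
    exact_mod_cast this
  have hp : (p : ℝ) + 1 ≠ 0 := by positivity
  have e4 : ((p + 1).choose (i + 1) : ℝ) * ((p + 1 + i).choose (i + 1) - (p + 1 + i).choose i)
      = p.choose (i + 1) * (p + 1 + i).choose (i + 1) := by
    apply mul_right_cancel₀ hp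
    linear_combination ((p + 1).choose (i + 1) : ℝ) * e3 - ((p + 1 + i).choose (i + 1) : ℝ) * e2
  rw [add_zero, e1, show p + 1 + (i + 1) = p + 1 + i + 1 by ring,
    Nat.choose_succ_succ' (p + 1 + i) i, show p + (i + 1) = p + 1 + i by ring]
  push_cast
  linear_combination (-(-1 : ℝ) ^ i * y ^ (i + 1)) * e4

/-- `e^{-|n|η} * inversePowerCoeff p (legendreArg η) |n|`, `n ∈ ℤ`. -/
noncomputable def fourierInversePower (p : ℕ) (η : ℝ) (n : ℤ) : ℝ :=
  Real.exp (-(n.natAbs : ℝ) * η) * inversePowerCoeff p (legendreArg η) n.natAbs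

theorem fourierInversePower_neg (p : ℕ) (η : ℝ) (n : ℤ) :
    fourierInversePower p η (-n) = fourierInversePower p η n := by
  rw [fourierInversePower, fourierInversePower, Int.natAbs_neg]

theorem fourierInversePower_natCast (p : ℕ) (η : ℝ) (n : ℕ) :
    fourierInversePower p η n
      = Real.exp (-(n : ℝ) * η) * inversePowerCoeff p (legendreArg η) n := rfl

theorem summable_fourierInversePower {η : ℝ} (hη : 0 < η) (p : ℕ) :
    Summable (fourierInversePower p η) := by
  have h : Summable fun n : ℕ => fourierInversePower p η n := by
    simp only [fourierInversePower_natCast, inversePowerCoeff, Finset.mul_sum]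
    refine summable_sum fun j hj => ?_
    rw [Finset.mem_range] at hj
    have hr : ‖Real.exp (-η)‖ < 1 := by
      rw [Real.norm_eq_abs, abs_of_pos (Real.exp_pos _)]
      exact Real.exp_lt_one_iff.2 (neg_lt_zero.2 hη)
    have h0 := summable_choose_mul_geometric_of_norm_lt_one (p - j) hr
    have h1 : Summable fun n : ℕ =>
        (((n + j + (p - j)).choose (p - j) : ℕ) : ℝ) * Real.exp (-η) ^ (n + j) :=
      h0.comp_injective (add_left_injective j)
    refine (h1.mul_left (Real.exp (j * η) * ((-1) ^ j * (p + j).choose j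
      * legendreArg η ^ j))).congr fun n => ?_
    rw [show n + j + (p - j) = p + n by omega, ← Real.exp_nat_mul,
      show -(n : ℝ) * η = j * η + ((n + j : ℕ) : ℝ) * -η by push_cast; ring, Real.exp_add]
    ring
  refine Summable.of_nat_of_neg h ?_
  simpa only [fourierInversePower_neg] using h

theorem fourierInversePower_recurrence {η : ℝ} (hη : 0 < η) (p : ℕ) (n : ℤ) :
    Real.cosh η * fourierInversePower (p + 1) η n
      - (fourierInversePower (p + 1) η (n - 1) + fourierInversePower (p + 1) η (n + 1)) / 2
      = Real.sinh η * fourierInversePower p η n := by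
  have h1 := sinh_mul_legendreArg hη
  have h2 := sinh_mul_one_sub_legendreArg hη
  have hc := Real.cosh_eq η
  have hE : Real.exp η * Real.exp (-η) = 1 := by rw [← Real.exp_add]; simp
  have hpos : ∀ m : ℕ, Real.cosh η * fourierInversePower (p + 1) η (m + 1 : ℕ)
      - (fourierInversePower (p + 1) η m + fourierInversePower (p + 1) η (m + 2 : ℕ)) / 2
      = Real.sinh η * fourierInversePower p η (m + 1 : ℕ) := by
    intro m
    have h := inversePowerCoeff_recurrence p (legendreArg η) m
    have x1 : Real.exp (-((m + 1 : ℕ) : ℝ) * η) = Real.exp (-(m : ℝ) * η) * Real.exp (-η) := by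
      rw [← Real.exp_add]; push_cast; ring_nf
    have x2 : Real.exp (-((m + 2 : ℕ) : ℝ) * η)
        = Real.exp (-(m : ℝ) * η) * (Real.exp (-η) * Real.exp (-η)) := by
      rw [← Real.exp_add, ← Real.exp_add]; push_cast; ring_nf
    simp only [fourierInversePower_natCast]
    rw [x1, x2, hc, ← h]
    set G0 := inversePowerCoeff (p + 1) (legendreArg η) m
    set G1 := inversePowerCoeff (p + 1) (legendreArg η) (m + 1)
    set G2 := inversePowerCoeff (p + 1) (legendreArg η) (m + 2)
    linear_combination Real.exp (-(m : ℝ) * η) * (G0 / 2 * hE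
      - Real.exp (-η) * (G1 - G0) * h2 - Real.exp (-η) * (G2 - G1) * h1)
  rcases lt_trichotomy n 0 with hn | rfl | hn
  · obtain ⟨m, rfl⟩ : ∃ m : ℕ, n = -((m + 1 : ℕ) : ℤ) := ⟨(-n - 1).toNat, by omega⟩
    rw [show -((m + 1 : ℕ) : ℤ) - 1 = -((m + 2 : ℕ) : ℤ) by push_cast; ring,
      show -((m + 1 : ℕ) : ℤ) + 1 = -(m : ℤ) by push_cast; ring]
    simp only [fourierInversePower_neg]
    rw [← hpos m]
    ring
  · have h := inversePowerCoeff_recurrence_zero p (legendreArg η)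
    have s0 : ∀ q, fourierInversePower q η 0 = inversePowerCoeff q (legendreArg η) 0 := by
      intro q; simp [fourierInversePower]
    have s1 : fourierInversePower (p + 1) η (0 + 1)
        = Real.exp (-η) * inversePowerCoeff (p + 1) (legendreArg η) 1 := by
      simp [fourierInversePower]
    rw [show (0 : ℤ) - 1 = -(0 + 1) by ring, fourierInversePower_neg, s1, s0, s0, ← h]
    have h3 := Real.cosh_sub_sinh η
    set G0 := inversePowerCoeff (p + 1) (legendreArg η) 0
    set G1 := inversePowerCoeff (p + 1) (legendreArg η) 1
    linear_combination G0 * h3 - 2 * (G1 - G0) * h1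
  · obtain ⟨m, rfl⟩ : ∃ m : ℕ, n = ((m + 1 : ℕ) : ℤ) := ⟨(n - 1).toNat, by omega⟩
    rw [show ((m + 1 : ℕ) : ℤ) - 1 = (m : ℤ) by push_cast; ring,
      show ((m + 1 : ℕ) : ℤ) + 1 = ((m + 2 : ℕ) : ℤ) by push_cast; ring]
    exact hpos m

theorem summable_cos_mul {b : ℤ → ℝ} (hb : Summable b) (t : ℤ → ℝ) :
    Summable fun n : ℤ => Real.cos (t n) * b n := by
  refine Summable.of_norm_bounded hb.norm fun n => ?_
  rw [norm_mul]
  exact mul_le_of_le_one_left (norm_nonneg _) (Real.abs_cos_le_one _)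

/-- Multiplication of a cosine series by `x - cos ψ` acts on the coefficients as a three-term
difference operator. -/
theorem hasSum_sub_cos_mul {b : ℤ → ℝ} (hb : Summable b) (x ψ : ℝ) :
    HasSum (fun n : ℤ => Real.cos (n * ψ) * (x * b n - (b (n - 1) + b (n + 1)) / 2))
      ((x - Real.cos ψ) * ∑' n : ℤ, Real.cos (n * ψ) * b n) := by
  have h0 := (summable_cos_mul hb fun n => n * ψ).hasSum
  have hp := (summable_cos_mul hb fun n => (n + 1) * ψ).hasSum
  have hm := (summable_cos_mul hb fun n => (n - 1) * ψ).hasSum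
  have e : (∑' n : ℤ, Real.cos ((n + 1) * ψ) * b n) + ∑' n : ℤ, Real.cos ((n - 1) * ψ) * b n
      = 2 * Real.cos ψ * ∑' n : ℤ, Real.cos (n * ψ) * b n := by
    refine (hp.add hm).unique ((h0.mul_left (2 * Real.cos ψ)).congr_fun fun n => ?_)
    rw [add_mul (n : ℝ), sub_mul (n : ℝ), one_mul, Real.cos_add, Real.cos_sub]
    ring
  have hp' := (Equiv.subRight (1 : ℤ)).hasSum_iff.2 hp
  have hm' := (Equiv.addRight (1 : ℤ)).hasSum_iff.2 hm
  have := (h0.mul_left x).sub ((hp'.add hm').mul_left (1 / 2))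
  rw [e] at this
  convert! this using 1
  · funext n
    simp only [Function.comp_apply, Equiv.coe_addRight, Equiv.subRight_apply]
    push_cast
    rw [sub_add_cancel, add_sub_cancel_right]
    ring
  · ring

theorem cosh_sub_cos_pos {η : ℝ} (hη : 0 < η) (ψ : ℝ) : 0 < Real.cosh η - Real.cos ψ :=
  sub_pos.2 ((Real.cos_le_one ψ).trans_lt (Real.one_lt_cosh.2 hη.ne'))

theorem hasSum_fourierInversePower {η : ℝ} (hη : 0 < η) (ψ : ℝ) (p : ℕ) :
    HasSum (fun n : ℤ => Real.cos (n * ψ) * fourierInversePower p η n)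
      ((Real.sinh η / (Real.cosh η - Real.cos ψ)) ^ (p + 1)) := by
  have hx := (cosh_sub_cos_pos hη ψ).ne'
  have hsum := summable_fourierInversePower hη
  have step : ∀ q : ℕ, HasSum (fun n : ℤ => Real.cos (n * ψ)
        * (Real.cosh η * fourierInversePower q η n
          - (fourierInversePower q η (n - 1) + fourierInversePower q η (n + 1)) / 2))
        ((Real.sinh η / (Real.cosh η - Real.cos ψ)) ^ q * Real.sinh η) →
      HasSum (fun n : ℤ => Real.cos (n * ψ) * fourierInversePower q η n)
        ((Real.sinh η / (Real.cosh η - Real.cos ψ)) ^ (q + 1)) := by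
    intro q h
    have h1 := h.unique (hasSum_sub_cos_mul (hsum q) (Real.cosh η) ψ)
    have h2 := (summable_cos_mul (hsum q) fun n => n * ψ).hasSum
    convert h2 using 1
    apply mul_left_cancel₀ hx
    rw [← h1, pow_succ]
    field_simp
  induction p with
  | zero =>
    refine step 0 ?_
    -- for `p = 0` the difference operator leaves the coefficient of index `0` only
    have hrec : ∀ n : ℤ, n ≠ 0 → Real.cosh η * fourierInversePower 0 η n
        - (fourierInversePower 0 η (n - 1) + fourierInversePower 0 η (n + 1)) / 2 = 0 := by
      have h0 : ∀ n, fourierInversePower 0 η n = Real.exp (-(n.natAbs : ℝ) * η) := by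
        intro n; simp [fourierInversePower, inversePowerCoeff]
      intro n hn
      obtain ⟨m, hm⟩ : ∃ m : ℕ, n.natAbs = m + 1 := ⟨n.natAbs - 1, by omega⟩
      have h1 : fourierInversePower 0 η (n - 1) + fourierInversePower 0 η (n + 1)
          = Real.exp (-(m : ℝ) * η) + Real.exp (-((m + 2 : ℕ) : ℝ) * η) := by
        rw [h0, h0]
        rcases lt_or_gt_of_ne hn with h | h
        · rw [show (n - 1).natAbs = m + 2 by omega, show (n + 1).natAbs = m by omega, add_comm]
        · rw [show (n + 1).natAbs = m + 2 by omega, show (n - 1).natAbs = m by omega]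
      rw [h1, h0, hm, Real.cosh_eq,
        show -(m : ℝ) * η = -((m + 1 : ℕ) : ℝ) * η + η by push_cast; ring,
        show -((m + 2 : ℕ) : ℝ) * η = -((m + 1 : ℕ) : ℝ) * η + -η by push_cast; ring,
        Real.exp_add, Real.exp_add]
      ring
    have h := hasSum_single (f := fun n : ℤ => Real.cos (n * ψ)
        * (Real.cosh η * fourierInversePower 0 η n
          - (fourierInversePower 0 η (n - 1) + fourierInversePower 0 η (n + 1)) / 2)) 0
      fun n hn => by rw [hrec n hn, mul_zero]
    convert h using 1
    have := Real.cosh_sub_sinh η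
    simp [fourierInversePower, inversePowerCoeff]
    linarith
  | succ p ih =>
    refine step (p + 1) ?_
    simp only [fourierInversePower_recurrence hη]
    refine (ih.mul_right (Real.sinh η)).congr_fun fun n => ?_
    ring

theorem hasSum_endingFun {η : ℝ} (hη : 0 < η) (p : ℕ) (ψ : ℝ) :
    HasSum
      (fun n : ℕ =>
        (-1 : ℝ) ^ (p + 1) / (2 * (p.factorial : ℝ) ^ 2 * Real.sinh η ^ (2 * p + 1)) *
          (neumannFactor n * Real.cos ((n : ℝ) * ψ) * Real.exp (-(n : ℝ) * η)
            * endingFun n p (Real.cosh η)))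
      (1 / (Real.cosh η - Real.cos ψ) ^ (p + 1)) := by
  have hs : Real.sinh η ≠ 0 := (Real.sinh_pos_iff.2 hη).ne'
  have hcoeff : ∀ n : ℕ, endingFun n p (Real.cosh η)
      = 2 * (-1) ^ (p + 1) * Real.sinh η ^ p * (p.factorial : ℝ) ^ 2
        * inversePowerCoeff p (legendreArg η) n := by
    intro n
    rw [endingFun_cosh_eq_sum hη, inversePowerCoeff, mul_assoc _ ((p.factorial : ℝ) ^ 2)]
    congr 1
    rw [Finset.mul_sum]
    refine Finset.sum_congr rfl fun j hj => ?_
    rw [Finset.mem_range] at hj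
    rw [Nat.cast_choose ℝ (show j ≤ p by omega), Nat.cast_choose ℝ (show p - j ≤ p + n by omega),
      Nat.cast_choose ℝ (show j ≤ p + j by omega), show p + n - (p - j) = n + j by omega,
      Nat.add_sub_cancel, add_comm n p]
    field_simp
  have h1 := (hasSum_fourierInversePower hη ψ p).nat_add_neg.sub
    (hasSum_ite_eq 0 (Real.cos ((0 : ℤ) * ψ) * fourierInversePower p η 0))
  have h2 := h1.mul_left (1 / Real.sinh η ^ (p + 1))
  have hm : ((-1 : ℝ) ^ (p + 1)) * (-1) ^ (p + 1) = 1 := by rw [← mul_pow]; simp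
  convert! h2 using 1
  · funext n
    rw [fourierInversePower_neg, fourierInversePower_natCast, hcoeff]
    have e : (-1 : ℝ) ^ (p + 1) / (2 * (p.factorial : ℝ) ^ 2 * Real.sinh η ^ (2 * p + 1))
        * (2 * (-1) ^ (p + 1) * Real.sinh η ^ p * (p.factorial : ℝ) ^ 2)
        = 1 / Real.sinh η ^ (p + 1) := by
      have hf : (p.factorial : ℝ) ≠ 0 := by positivity
      rw [div_mul_eq_mul_div, div_eq_div_iff (by positivity) (by positivity)]
      rw [show 2 * p + 1 = p + (p + 1) by ring, pow_add _ p (p + 1)]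
      linear_combination 2 * Real.sinh η ^ p * (p.factorial : ℝ) ^ 2 * Real.sinh η ^ (p + 1) * hm
    have e' : ∀ a b : ℝ,
        (-1 : ℝ) ^ (p + 1) / (2 * (p.factorial : ℝ) ^ 2 * Real.sinh η ^ (2 * p + 1))
        * (a * (2 * (-1) ^ (p + 1) * Real.sinh η ^ p * (p.factorial : ℝ) ^ 2 * b))
        = 1 / Real.sinh η ^ (p + 1) * (a * b) := by
      intro a b
      rw [← e]
      ring
    have hcos : Real.cos (((-(n : ℤ) : ℤ) : ℝ) * ψ) = Real.cos (n * ψ) := by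
      push_cast
      rw [neg_mul, Real.cos_neg]
    rw [e', hcos]
    congr 1
    rcases n with _ | n
    · simp [neumannFactor, fourierInversePower]
    · rw [if_neg (Nat.succ_ne_zero n), neumannFactor, if_neg (Nat.succ_ne_zero n),
        Int.cast_natCast]
      ring
  · have := (cosh_sub_cos_pos hη ψ).ne'
    rw [div_pow]
    field_simp
    simp

/-! ### Logarithmic sums, ending functions and the Fourier expansion -/

theorem mainTheorem3 (η : ℝ) (hη : 0 < η) :
    -- `n = 0`, `p ≥ 1`
    (∀ p : ℕ, 1 ≤ p →
      ∑ k ∈ Finset.Icc 1 p,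
          (-1 : ℝ) ^ (k + 1) * Real.exp (-(k : ℝ) * η) * (logPoly p k).eval (Real.cosh η) / (k : ℝ)
        = Real.sinh η ^ p * (realDigamma (2 * p + 1) - realDigamma (p + 1))
            * legendreP p 0 (Real.cosh η / Real.sinh η)
          + (-1 : ℝ) ^ p * Real.sinh η ^ p *
            ∑ k ∈ Finset.range p,
              (-1 : ℝ) ^ k * (2 * (k : ℝ) + 1) / (((p : ℝ) - k) * ((p : ℝ) + k + 1))
                * legendreP k 0 (Real.cosh η / Real.sinh η)) ∧
    -- `1 ≤ n ≤ p - 1`, `p ≥ 2`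
    (∀ p n : ℕ, 1 ≤ n → n + 1 ≤ p →
      ∑ k ∈ Finset.Icc (-(p : ℤ)) ((n : ℤ) - 1),
          (-1 : ℝ) ^ (k + 1) * Real.exp ((k : ℝ) * η) * (logPoly p k).eval (Real.cosh η)
            / ((n : ℝ) - (k : ℝ))
        + Real.exp (2 * (n : ℝ) * η) *
          ∑ k ∈ Finset.Icc (-(p : ℤ)) (-(n : ℤ) - 1),
            (-1 : ℝ) ^ k * Real.exp ((k : ℝ) * η) * (logPoly p k).eval (Real.cosh η)
              / ((n : ℝ) + (k : ℝ))
        = (p.factorial : ℝ) * Real.exp ((n : ℝ) * η) * Real.sinh η ^ p *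
          ((-1 : ℝ) ^ n / ((p + n).factorial : ℝ)
              * (2 * realDigamma (2 * p + 1) - realDigamma (p + 1 + n) - realDigamma (p + 1 - n))
              * legendreP p n (Real.cosh η / Real.sinh η)
            + (-1 : ℝ) ^ p / ((p + n).factorial : ℝ) *
              ∑ k ∈ Finset.range (p - n),
                (-1 : ℝ) ^ k * (2 * (n : ℝ) + 2 * k + 1)
                  * (1 + ((k.factorial : ℝ) * ((p + n).factorial : ℝ))
                      / (((2 * n + k).factorial : ℝ) * ((p - n).factorial : ℝ)))
                  / (((p : ℝ) - n - k) * ((p : ℝ) + n + k + 1))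
                  * legendreP (n + k) n (Real.cosh η / Real.sinh η)
            + (-1 : ℝ) ^ (p + n) / ((p - n).factorial : ℝ) *
              ∑ k ∈ Finset.range n,
                (-1 : ℝ) ^ k * (2 * (k : ℝ) + 1) / (((p : ℝ) - k) * ((p : ℝ) + k + 1))
                  * legendreP k (-(n : ℤ)) (Real.cosh η / Real.sinh η))) ∧
    -- `n = p ≥ 1`
    (∀ p : ℕ, 1 ≤ p →
      ∑ k ∈ Finset.Icc (-(p : ℤ)) ((p : ℤ) - 1),
          (-1 : ℝ) ^ (k + 1) * Real.exp ((k : ℝ) * η) * (logPoly p k).eval (Real.cosh η)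
            / ((p : ℝ) - (k : ℝ))
        = (p.factorial : ℝ) * Real.exp ((p : ℝ) * η) * Real.sinh η ^ p *
          ((-1 : ℝ) ^ p / ((2 * p).factorial : ℝ) * (realDigamma (2 * p + 1) - realDigamma 1)
              * legendreP p p (Real.cosh η / Real.sinh η)
            + ∑ k ∈ Finset.range p,
                (-1 : ℝ) ^ k * (2 * (k : ℝ) + 1) / (((p : ℝ) - k) * ((p : ℝ) + k + 1))
                  * legendreP k (-(p : ℤ)) (Real.cosh η / Real.sinh η))) ∧
    -- `n ≥ p + 1`, `p ≥ 0`
    (∀ p n : ℕ, p + 1 ≤ n →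
      ∑ k ∈ Finset.Icc (-(p : ℤ)) (p : ℤ),
          (-1 : ℝ) ^ (k + 1) * Real.exp ((k : ℝ) * η) * (logPoly p k).eval (Real.cosh η)
            / ((n : ℝ) - (k : ℝ))
        = (-1 : ℝ) ^ (p + 1) * (p.factorial : ℝ) * ((n - p - 1).factorial : ℝ)
            * Real.exp ((n : ℝ) * η) * Real.sinh η ^ p
            * legendreP p (-(n : ℤ)) (Real.cosh η / Real.sinh η)) ∧
    -- the ending function is `(n+p)!/(n-p-1)! · 𝔯_{n,p}^{-p,p}` for `n ≥ p + 1`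
    (∀ p n : ℕ, p + 1 ≤ n →
      endingFun n p (Real.cosh η)
        = ((n + p).factorial : ℝ) / ((n - p - 1).factorial : ℝ)
            * logSum n p (-(p : ℤ)) p (Real.cosh η)) ∧
    -- closed form of the ending function, for all `n ≥ 0`
    (∀ p n : ℕ,
      endingFun n p (Real.cosh η)
        = 2 * (-1 : ℝ) ^ (p + 1) * (p.factorial : ℝ) * ((p + n).factorial : ℝ)
            * Real.exp ((n : ℝ) * η) * Real.sinh η ^ p
            * legendreP p (-(n : ℤ)) (Real.cosh η / Real.sinh η)) ∧
    -- Fourier cosine series of `(cosh η - cos ψ)^{-q}`, `q ≥ 1`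
    (∀ q : ℕ, 1 ≤ q → ∀ ψ : ℝ,
      HasSum
        (fun n : ℕ =>
          (-1 : ℝ) ^ q / (2 * ((q - 1).factorial : ℝ) ^ 2 * Real.sinh η ^ (2 * q - 1)) *
            (neumannFactor n * Real.cos ((n : ℝ) * ψ) * Real.exp (-(n : ℝ) * η)
              * endingFun n (q - 1) (Real.cosh η)))
        (1 / (Real.cosh η - Real.cos ψ) ^ q)) := by
  refine ⟨fun p _ => sum_logPoly_div_zero hη p, fun p n _ hn => sum_logPoly_div_of_lt hη p n hn,
    fun p _ => sum_logPoly_div_self hη p, fun p n h => sum_logPoly_div_of_gt hη h,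
    fun p n h => endingFun_eq_mul_logSum h _, fun p n => endingFun_cosh_eq_legendreP hη p n, ?_⟩
  intro q hq ψ
  obtain ⟨p, rfl⟩ : ∃ p, q = p + 1 := ⟨q - 1, by omega⟩
  exact hasSum_endingFun hη p ψ
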